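/- Let $\Omega=[0,1]\times[-1,1]\subset\mathbb R^2$ (coordinates $(r,z)$), with interior $\Omega^\circ=(0,1)\times(-1,1)$, and let $U=\{(x,y)\in\mathbb R^2: x^2+y^2\le 1\}\times[-1,1]\subset\mathbb R^3$. A function $u:U\to\mathbb R$ is axisymmetric if it is invariant under all rotations about the $z$-axis; it is then identified with the function $u(r,z):=u(r,0,z)$ on $\Omega$, and it is extended by zero outside $U$. Its Abel transform is $$\mathcal A u(x,z)=2\int_x^\infty \frac{u(r,z)\,r}{\sqrt{r^2-x^2}}\,dr ,\qquad (x,z)\in\Omega .$$ The total variation of $u$ is $$\|u\|_{TV(\Omega)}=\sup\Big\{\iint_{\Omega^\circ} u(r,z)\,\operatorname{div}\phi(r,z)\,dr\,dz:\ \phi\in C^1_c(\Omega^\circ;\mathbb R^2),\ \|\phi\|_{L^\infty}\le 1\Big\},$$ and $u\in BV(\Omega)$ means $u\in L^1(\Omega)$ and $\|u\|_{TV(\Omega)}<\infty$. **Theorem.** There is an absolute constant $C$ such that the following holds. Let $u:U\to\mathbb R$ be axisymmetric and such that, as a function of $(r,z)$, $u\in BV(\Omega)\cap L^\infty(\Omega)$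 and the (essential) support of $u$ in $\Omega$ is contained in $[0,1)\times[-1,1]$. Let $f=\mathcal A u$ a.e. on $\Omega$. Then the integral defining $\mathcal A u(x,z)$ converges absolutely for a.e. $(x,z)\in\Omega$, $f\in L^2(\Omega)$, $u\in L^2(U)$, and $$\|u\|_{L^2(U)}\le C\,\|u\|_{L^\infty(\Omega)}^{1/3}\,\|u\|_{TV(\Omega)}^{1/3}\,\|f\|_{L^2(\Omega)}^{1/3},\qquad \|u\|_{L^2(U)}=\Big(\int_{-1}^1\iint_{x^2+y^2\le1}|u(x,y,z)|^2\,dx\,dy\,dz\Big)^{1/2}.$$ -/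

import Mathlib

open MeasureTheory Set
open scoped ENNReal NNReal Topology

noncomputable section

namespace AbelStability

/-- The rectangle `[0,1] × [-1,1]` of cylindrical coordinates `(r, z)`. -/
def Omega : Set (ℝ × ℝ) := Icc 0 1 ×ˢ Icc (-1) 1

/-- The closed solid cylinder `{x² + y² ≤ 1} × [-1,1]`; a point of `ℝ³` is written `((x, y), z)`. -/
def cylinder : Set ((ℝ × ℝ) × ℝ) := {q | q.1 ^ 2 + q.2 ^ 2 ≤ 1} ×ˢ Icc (-1) 1

/-- Rotation of `ℝ³` about the `z`-axis by the angle `θ`. -/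
def rotZ (θ : ℝ) (p : (ℝ × ℝ) × ℝ) : (ℝ × ℝ) × ℝ :=
  ((Real.cos θ * p.1.1 - Real.sin θ * p.1.2, Real.sin θ * p.1.1 + Real.cos θ * p.1.2), p.2)

/-- `u` is axisymmetric on `S`: invariant under all rotations about the `z`-axis. -/
def IsAxisymmetricOn (u : (ℝ × ℝ) × ℝ → ℝ) (S : Set ((ℝ × ℝ) × ℝ)) : Prop :=
  ∀ p ∈ S, ∀ θ : ℝ, u (rotZ θ p) = u p

/-- An axisymmetric function as a function of the cylindrical coordinates `(r, z)`. -/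
def profile (u : (ℝ × ℝ) × ℝ → ℝ) (p : ℝ × ℝ) : ℝ := u ((p.1, 0), p.2)

/-- The integrand of the Abel transform at `(x, z)`. -/
def abelIntegrand (u : (ℝ × ℝ) × ℝ → ℝ) (p : ℝ × ℝ) (r : ℝ) : ℝ :=
  profile u (r, p.2) * r / Real.sqrt (r ^ 2 - p.1 ^ 2)

/-- The Abel transform `𝒜u(x, z) = 2 ∫_x^∞ u(r, z) r / √(r² - x²) dr`. -/
def abelTransform (u : (ℝ × ℝ) × ℝ → ℝ) (p : ℝ × ℝ) : ℝ :=
  2 * ∫ r in Ioi p.1, abelIntegrand u p r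

/-- The divergence of a vector field on the `(r, z)`-plane. -/
def divergence (φ : ℝ × ℝ → EuclideanSpace ℝ (Fin 2)) (p : ℝ × ℝ) : ℝ :=
  fderiv ℝ φ p (1, 0) 0 + fderiv ℝ φ p (0, 1) 1

/-- Admissible test fields on the open set `W`: `φ ∈ C¹_c(W; ℝ²)` with `|φ| ≤ 1` everywhere. -/
structure IsTestField (W : Set (ℝ × ℝ)) (φ : ℝ × ℝ → EuclideanSpace ℝ (Fin 2)) : Prop where
  contDiff : ContDiff ℝ 1 φ
  hasCompactSupport : HasCompactSupport φ
  tsupport_subset : tsupport φ ⊆ W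
  norm_le_one : ∀ p, ‖φ p‖ ≤ 1

/-- The total variation of `v` over the open set `W`. As test fields are closed under negation,
truncating the integrals at `0` does not change the supremum. -/
def totalVariation (v : ℝ × ℝ → ℝ) (W : Set (ℝ × ℝ)) : ℝ≥0∞ :=
  ⨆ (φ : ℝ × ℝ → EuclideanSpace ℝ (Fin 2)) (_ : IsTestField W φ),
    ENNReal.ofReal (∫ p in W, v p * divergence φ p)

/-- `v ∈ BV(W)`: `v ∈ L¹(W)` with finite total variation. -/
def IsBV (v : ℝ × ℝ → ℝ) (W : Set (ℝ × ℝ)) : Prop :=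
  MemLp v 1 (volume.restrict W) ∧ totalVariation v W ≠ ∞

/-- The (essential) support of `v` as a measurable function on `S`: the points all of whose
neighbourhoods meet `{v ≠ 0} ∩ S` in positive measure. -/
def essSupport (v : ℝ × ℝ → ℝ) (S : Set (ℝ × ℝ)) : Set (ℝ × ℝ) :=
  {p | ∀ V ∈ 𝓝 p, volume.restrict S (V ∩ {q | v q ≠ 0}) ≠ 0}

end AbelStability

end

/-!
The measure `2r dr` on `(0, 1)` is Lebesgue measure in `s = r²`, and with respect to it the Abel
transform is an integral operator with kernel `1 / √(r² - x²)` on `x < r`, that is, half-order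
integration in `s` up to the factor `√π`. Composing the kernel with itself gives `π` times plain
integration (`lintegral_abelKernel_mul_abelKernel`), so a primitive of `u` in `s` is controlled by
the Abel transform of `u`, while the derivative of `u` in `r` is controlled by the total variation.
The `L²` norm of `u` is obtained by interpolating between the two.

The interpolation is done by duality, with no slicing of `BV` functions. Given a `C¹` test function
`ψ` with `|ψ| ≤ M = ‖u‖_∞` and a scale `h > 0`, let `η` solve `η + h ∂_s η = ψ`, `η = 0` at `r = 0`
(`radialSmoothing`), and write `∫ u ψ = ∫ u (ψ - η) + ∫ u η`.

* Since `ψ - η = h ∂_s η` and `|η| ≤ M`, the vector field `(η / M, 0)` is admissible in the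
  definition of the total variation after a cut-off near `r = 1`, where `u` vanishes; the first
  integral is at most `h M ‖u‖_TV` (`integral_mul_sub_radialSmoothing_le`).
* Since `η` is `h⁻¹` times the primitive of `ψ - η`, the second integral is `(π h)⁻¹` times the
  pairing of the Abel transform `f` with the adjoint Abel transform of `ψ - η`. The adjoint is
  bounded on `L²` by Schur's test, and `‖ψ - η‖₂ ≤ ‖ψ‖₂` by an energy estimate, so the integral is
  at most `(C / h) ‖f‖₂ ‖ψ‖₂` (`integral_mul_radialSmoothing_le`).

Letting `ψ` tend to `u` through mollifications bounded by `M` gives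
`‖u‖₂² ≤ h M ‖u‖_TV + (C / h) ‖f‖₂ ‖u‖₂` for every `h > 0`, and optimizing in `h` gives
`‖u‖₂³ ≤ 4 C M ‖u‖_TV ‖f‖₂` (`sqrt_integral_sq_pow_three_le`).

All of this is carried out for a bounded Borel function `v` that represents the profile of `u` and
vanishes off the open rectangle and near `r = 1` (`exists_bounded_representative`); cylindrical
coordinates (`lintegral_cylinder`) and Fubini's theorem (`ae_abelIntegrand_eq`) transfer the result
to `u`.
-/

noncomputable section

namespace AbelStability

/-! ### A Schur test -/

/-- Schur's test: an integral operator whose nonnegative kernel has row integrals at most `A` and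
column integrals at most `B` has squared `L²` norm at most `A * B`. -/
theorem lintegral_sq_lintegral_kernel_le {α β : Type*} [MeasurableSpace α] [MeasurableSpace β]
    {μ : Measure α} {ν : Measure β} [SFinite μ] [SFinite ν] {K : α → β → ℝ≥0∞}
    (hK : Measurable (Function.uncurry K)) {A B : ℝ≥0∞}
    (hA : ∀ᵐ x ∂μ, ∫⁻ y, K x y ∂ν ≤ A) (hB : ∀ᵐ y ∂ν, ∫⁻ x, K x y ∂μ ≤ B)
    {F : β → ℝ≥0∞} (hF : Measurable F) :
    ∫⁻ x, (∫⁻ y, K x y * F y ∂ν) ^ 2 ∂μ ≤ A * B * ∫⁻ y, F y ^ 2 ∂ν := by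
  have hKx (x : α) : Measurable (K x) := hK.comp measurable_prodMk_left
  have hKy (y : β) : Measurable fun x => K x y := hK.comp measurable_prodMk_right
  -- Cauchy–Schwarz for `K * F = K ^ (1/2) * (K ^ (1/2) * F)`
  have hCS (x : α) : (∫⁻ y, K x y * F y ∂ν) ^ 2 ≤
      (∫⁻ y, K x y ∂ν) * ∫⁻ y, K x y * F y ^ 2 ∂ν := by
    have hconj : (2 : ℝ).HolderConjugate 2 := Real.HolderConjugate.two_two
    have h := ENNReal.lintegral_mul_le_Lp_mul_Lq ν hconj
      (f := fun y => K x y ^ (1 / 2 : ℝ)) (g := fun y => K x y ^ (1 / 2 : ℝ) * F y)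
      ((hKx x).pow_const _).aemeasurable (((hKx x).pow_const _).mul hF).aemeasurable
    have hhalf (a : ℝ≥0∞) : a ^ (1 / 2 : ℝ) * a ^ (1 / 2 : ℝ) = a := by
      rw [← ENNReal.rpow_add_of_nonneg _ _ (by norm_num) (by norm_num)]; norm_num
    have hsq (a : ℝ≥0∞) : (a ^ (1 / 2 : ℝ)) ^ (2 : ℕ) = a := by
      rw [pow_two, hhalf]
    have e1 : ∀ y, ((fun y => K x y ^ (1 / 2 : ℝ)) * fun y => K x y ^ (1 / 2 : ℝ) * F y) y
        = K x y * F y := fun y => by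
      simp only [Pi.mul_apply]; rw [← mul_assoc, hhalf]
    have e2 : ∀ y, (K x y ^ (1 / 2 : ℝ) * F y) ^ (2 : ℝ) = K x y * F y ^ 2 := fun y => by
      rw [ENNReal.rpow_ofNat, mul_pow, hsq]
    have e3 : ∀ y, (K x y ^ (1 / 2 : ℝ)) ^ (2 : ℝ) = K x y := fun y => by
      rw [ENNReal.rpow_ofNat, hsq]
    simp only [e1, e2, e3] at h
    calc _ ≤ _ := pow_le_pow_left' h 2
      _ = _ := by rw [mul_pow, hsq, hsq]
  calc ∫⁻ x, (∫⁻ y, K x y * F y ∂ν) ^ 2 ∂μ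
      ≤ ∫⁻ x, A * ∫⁻ y, K x y * F y ^ 2 ∂ν ∂μ := by
        apply lintegral_mono_ae
        filter_upwards [hA] with x hx
        exact (hCS x).trans (by gcongr)
    _ = A * ∫⁻ x, ∫⁻ y, K x y * F y ^ 2 ∂ν ∂μ := by
        rw [lintegral_const_mul]
        exact Measurable.lintegral_prod_right (f := fun x y => K x y * F y ^ 2)
          (hK.mul ((hF.comp measurable_snd).pow_const 2))
    _ = A * ∫⁻ y, (∫⁻ x, K x y ∂μ) * F y ^ 2 ∂ν := by
        rw [lintegral_lintegral_swap]
        · congr 1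
          refine lintegral_congr fun y => ?_
          rw [lintegral_mul_const _ (hKy y)]
        · exact (hK.mul ((hF.comp measurable_snd).pow_const 2)).aemeasurable
    _ ≤ A * ∫⁻ y, B * F y ^ 2 ∂ν := by
        gcongr 1
        apply lintegral_mono_ae
        filter_upwards [hB] with y hy
        gcongr
    _ = A * B * ∫⁻ y, F y ^ 2 ∂ν := by
        rw [lintegral_const_mul _ (hF.pow_const 2), mul_assoc]

/-! ### The Abel kernel -/

/-- The measure `2r dr` on `(0, 1)`, i.e. Lebesgue measure in the variable `s = r²`. -/
def radialMeasure : Measure ℝ :=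
  (volume.restrict (Ioo 0 1)).withDensity fun r => ENNReal.ofReal (2 * r)

/-- The kernel of the Abel transform with respect to `radialMeasure`. -/
def abelKernel (x r : ℝ) : ℝ := if x < r then 1 / Real.sqrt (r ^ 2 - x ^ 2) else 0

theorem abelKernel_nonneg (x r : ℝ) : 0 ≤ abelKernel x r := by
  unfold abelKernel; split_ifs <;> positivity

theorem measurable_abelKernel : Measurable (Function.uncurry abelKernel) := by
  unfold abelKernel Function.uncurry
  refine Measurable.ite (measurableSet_lt measurable_fst measurable_snd) ?_ measurable_const
  fun_prop

theorem measurable_abelKernel_right (x : ℝ) : Measurable (abelKernel x) :=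
  measurable_abelKernel.comp measurable_prodMk_left

theorem measurable_abelKernel_left (r : ℝ) : Measurable fun x => abelKernel x r :=
  measurable_abelKernel.comp measurable_prodMk_right

theorem measurable_radialDensity : Measurable fun r : ℝ => ENNReal.ofReal (2 * r) := by fun_prop

theorem ae_radialMeasure_mem : ∀ᵐ r ∂radialMeasure, r ∈ Ioo (0 : ℝ) 1 :=
  (withDensity_absolutelyContinuous _ _).ae_le (ae_restrict_mem measurableSet_Ioo)

theorem lintegral_radialMeasure {F : ℝ → ℝ≥0∞} (hF : Measurable F) :
    ∫⁻ r, F r ∂radialMeasure = ∫⁻ r in Ioo 0 1, ENNReal.ofReal (2 * r) * F r := by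
  rw [radialMeasure, lintegral_withDensity_eq_lintegral_mul _ measurable_radialDensity hF]
  rfl

theorem integral_radialMeasure (F : ℝ → ℝ) :
    ∫ r, F r ∂radialMeasure = ∫ r in Ioo 0 1, 2 * r * F r := by
  rw [radialMeasure, integral_withDensity_eq_integral_toReal_smul measurable_radialDensity
    (ae_of_all _ fun _ => ENNReal.ofReal_lt_top)]
  refine setIntegral_congr_fun measurableSet_Ioo fun r hr => ?_
  have : 0 ≤ 2 * r := by linarith [hr.1]
  simp only [ENNReal.toReal_ofReal this, smul_eq_mul]

/-- The fundamental theorem of calculus for a nonnegative, possibly unbounded derivative. -/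
theorem lintegral_deriv_of_nonneg {g g' : ℝ → ℝ} {a b : ℝ} (hab : a ≤ b)
    (hcont : ContinuousOn g (Icc a b)) (hderiv : ∀ x ∈ Ioo a b, HasDerivAt g (g' x) x)
    (hpos : ∀ x ∈ Ioo a b, 0 ≤ g' x) :
    ∫⁻ x in Ioo a b, ENNReal.ofReal (g' x) = ENNReal.ofReal (g b - g a) := by
  have hint := intervalIntegral.integrableOn_deriv_of_nonneg hcont hderiv hpos
  rw [← ofReal_integral_eq_lintegral_ofReal (hint.mono_set Ioo_subset_Ioc_self)
    ((ae_restrict_iff' measurableSet_Ioo).2 (ae_of_all _ hpos)), ← integral_Ioc_eq_integral_Ioo,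
    ← intervalIntegral.integral_of_le hab]
  congr 1
  exact intervalIntegral.integral_eq_sub_of_hasDerivAt_of_le hab hcont hderiv
    ((intervalIntegrable_iff_integrableOn_Ioc_of_le hab).2 hint)

/-- Radial integrals of functions supported in `(a, b)` that have a primitive in `r`. -/
theorem lintegral_radialMeasure_of_hasDerivAt {F g g' : ℝ → ℝ} {a b : ℝ} (ha : 0 ≤ a)
    (hab : a ≤ b) (hb : b ≤ 1) (hF : Measurable F) (hF0 : ∀ x ∉ Ioo a b, F x = 0)
    (hcont : ContinuousOn g (Icc a b)) (hderiv : ∀ x ∈ Ioo a b, HasDerivAt g (g' x) x)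
    (hpos : ∀ x ∈ Ioo a b, 0 ≤ g' x) (hFg : ∀ x ∈ Ioo a b, 2 * x * F x = g' x) :
    ∫⁻ x, ENNReal.ofReal (F x) ∂radialMeasure = ENNReal.ofReal (g b - g a) := by
  rw [lintegral_radialMeasure hF.ennreal_ofReal, ← lintegral_deriv_of_nonneg hab hcont hderiv hpos,
    ← inter_eq_self_of_subset_left (Ioo_subset_Ioo ha hb), ← Measure.restrict_restrict
    measurableSet_Ioo, ← lintegral_indicator (s := Ioo a b) measurableSet_Ioo]
  refine setLIntegral_congr_fun measurableSet_Ioo fun x hx => ?_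
  by_cases h : x ∈ Ioo a b
  · have hx0 : 0 ≤ 2 * x := by linarith [hx.1]
    simp only [indicator_of_mem h]
    rw [← ENNReal.ofReal_mul hx0, hFg x h]
  · simp [indicator_of_notMem h, hF0 x h]

instance : IsFiniteMeasure radialMeasure := by
  constructor
  have h := lintegral_radialMeasure_of_hasDerivAt (F := (Ioo (0 : ℝ) 1).indicator fun _ => 1)
    (g := fun x => x ^ 2) (g' := fun x => 2 * x) (a := 0) (b := 1) le_rfl zero_le_one le_rfl
    (measurable_const.indicator measurableSet_Ioo)
    (fun x hx => by simp [hx]) (by fun_prop) (fun x _ => by simpa using hasDerivAt_pow 2 x)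
    (fun x hx => by linarith [hx.1]) (fun x hx => by simp [indicator_of_mem hx])
  rw [← setLIntegral_one, Measure.restrict_univ]
  calc ∫⁻ _, 1 ∂radialMeasure
      = ∫⁻ x, ENNReal.ofReal ((Ioo (0 : ℝ) 1).indicator (fun _ => 1) x) ∂radialMeasure := by
        refine lintegral_congr_ae ?_
        filter_upwards [ae_radialMeasure_mem] with x hx
        simp [indicator_of_mem hx]
    _ < ∞ := by rw [h]; exact ENNReal.ofReal_lt_top

theorem lintegral_abelKernel_right_le {x : ℝ} (hx : x ∈ Ioo (0 : ℝ) 1) :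
    ∫⁻ r, ENNReal.ofReal (abelKernel x r) ∂radialMeasure ≤ 2 := by
  have hk : ∀ r ∈ Ioo (0 : ℝ) 1, abelKernel x r = (Ioo x 1).indicator (abelKernel x) r := by
    intro r hr
    by_cases h : x < r
    · rw [indicator_of_mem (show r ∈ Ioo x 1 from ⟨h, hr.2⟩)]
    · rw [indicator_of_notMem (show r ∉ Ioo x 1 from fun h' => h h'.1)]; simp [abelKernel, h]
  have key := lintegral_radialMeasure_of_hasDerivAt (F := (Ioo x 1).indicator (abelKernel x))
    (g := fun r => 2 * Real.sqrt (r ^ 2 - x ^ 2))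
    (g' := fun r => 2 * r / Real.sqrt (r ^ 2 - x ^ 2)) hx.1.le hx.2.le le_rfl
    ((measurable_abelKernel_right x).indicator measurableSet_Ioo)
    (fun r hr => by simp [hr]) (by fun_prop) ?_ ?_ ?_
  · rw [lintegral_congr_ae (ae_radialMeasure_mem.mono fun r hr =>
      congrArg ENNReal.ofReal (hk r hr)), key]
    have h1 : Real.sqrt (1 ^ 2 - x ^ 2) ≤ 1 := by
      rw [Real.sqrt_le_one]; nlinarith [sq_nonneg x]
    refine (ENNReal.ofReal_le_ofReal (q := 2) ?_).trans (by simp)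
    simp only [sub_self, Real.sqrt_zero]; linarith
  · intro r hr
    have h0 : r ^ 2 - x ^ 2 ≠ 0 := by nlinarith [hr.1, hx.1]
    have := (((hasDerivAt_pow 2 r).sub_const (x ^ 2)).sqrt h0).const_mul 2
    convert! this using 1
    push_cast; field_simp
  · intro r hr
    have : 0 < r := hx.1.trans hr.1
    positivity
  · intro r hr
    simp only [indicator_of_mem hr, abelKernel, hr.1, if_true]
    ring

theorem lintegral_abelKernel_left_le {r : ℝ} (hr : r ∈ Ioo (0 : ℝ) 1) :
    ∫⁻ x, ENNReal.ofReal (abelKernel x r) ∂radialMeasure ≤ 2 := by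
  have hk : ∀ x ∈ Ioo (0 : ℝ) 1,
      abelKernel x r = (Ioo 0 r).indicator (fun x => abelKernel x r) x := by
    intro x hx
    by_cases h : x < r
    · rw [indicator_of_mem (show x ∈ Ioo 0 r from ⟨hx.1, h⟩)]
    · rw [indicator_of_notMem (show x ∉ Ioo 0 r from fun h' => h h'.2)]; simp [abelKernel, h]
  have key := lintegral_radialMeasure_of_hasDerivAt
    (F := (Ioo 0 r).indicator (fun x => abelKernel x r))
    (g := fun x => -(2 * Real.sqrt (r ^ 2 - x ^ 2)))
    (g' := fun x => 2 * x / Real.sqrt (r ^ 2 - x ^ 2)) le_rfl hr.1.le hr.2.le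
    ((measurable_abelKernel_left r).indicator measurableSet_Ioo)
    (fun x hx => by simp [hx]) (by fun_prop) ?_ ?_ ?_
  · rw [lintegral_congr_ae (ae_radialMeasure_mem.mono fun x hx =>
      congrArg ENNReal.ofReal (hk x hx)), key]
    have h1 : Real.sqrt (r ^ 2 - 0 ^ 2) ≤ 1 := by
      rw [Real.sqrt_le_one]; nlinarith [hr.1, hr.2]
    refine (ENNReal.ofReal_le_ofReal (q := 2) ?_).trans (by simp)
    simp only [sub_self, Real.sqrt_zero]; linarith
  · intro x hx
    have h0 : r ^ 2 - x ^ 2 ≠ 0 := by nlinarith [hx.1, hx.2]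
    have := ((((hasDerivAt_pow 2 x).const_sub (r ^ 2)).sqrt h0).const_mul 2).neg
    convert! this using 1
    push_cast; field_simp
  · intro x hx
    have : 0 < x := hx.1
    positivity
  · intro x hx
    simp only [indicator_of_mem hx, abelKernel, hx.2, if_true]
    ring

/-- The Abel kernel composed with itself is `π` times the kernel of integration. In the variable
`s = x²` this is the Beta integral `∫ ds / √((s - ρ²)(r² - s)) = π`, whose primitive is an
arcsine. -/
theorem lintegral_abelKernel_mul_abelKernel {ρ r : ℝ} (hρ : ρ ∈ Ioo (0 : ℝ) 1)
    (hr : r ∈ Ioo (0 : ℝ) 1) :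
    ∫⁻ x, ENNReal.ofReal (abelKernel ρ x * abelKernel x r) ∂radialMeasure =
      ENNReal.ofReal (if ρ < r then Real.pi else 0) := by
  split_ifs with h
  swap
  · have : ∀ x, abelKernel ρ x * abelKernel x r = 0 := by
      intro x
      by_cases h1 : ρ < x
      · have : ¬ x < r := fun h2 => h (h1.trans h2)
        simp [abelKernel, this]
      · simp [abelKernel, h1]
    simp [this]
  have hD : 0 < r ^ 2 - ρ ^ 2 := by nlinarith [hρ.1]
  have key := lintegral_radialMeasure_of_hasDerivAt
    (F := fun x => abelKernel ρ x * abelKernel x r)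
    (g := fun x => Real.arcsin ((2 * x ^ 2 - ρ ^ 2 - r ^ 2) / (r ^ 2 - ρ ^ 2)))
    (g' := fun x => 2 * x * (abelKernel ρ x * abelKernel x r)) hρ.1.le h.le hr.2.le
    ((measurable_abelKernel_right ρ).mul (measurable_abelKernel_left r)) ?_ ?_ ?_ ?_
    (fun _ _ => rfl)
  · rw [key]
    have e1 : (2 * r ^ 2 - ρ ^ 2 - r ^ 2) / (r ^ 2 - ρ ^ 2) = 1 := by
      rw [div_eq_one_iff_eq hD.ne']; ring
    have e2 : (2 * ρ ^ 2 - ρ ^ 2 - r ^ 2) / (r ^ 2 - ρ ^ 2) = -1 := by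
      rw [div_eq_iff hD.ne']; ring
    rw [e1, e2, Real.arcsin_one, Real.arcsin_neg_one]
    congr 1; ring
  · intro x hx
    by_cases h1 : ρ < x
    · have : ¬ x < r := fun h2 => hx ⟨h1, h2⟩
      simp [abelKernel, this]
    · simp [abelKernel, h1]
  · exact Real.continuous_arcsin.comp_continuousOn (by fun_prop)
  · intro x hx
    have hx0 : 0 < x := hρ.1.trans hx.1
    have h1 : 0 < x ^ 2 - ρ ^ 2 := by nlinarith [hx.1, hρ.1]
    have h2 : 0 < r ^ 2 - x ^ 2 := by nlinarith [hx.2]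
    set y := (2 * x ^ 2 - ρ ^ 2 - r ^ 2) / (r ^ 2 - ρ ^ 2) with hy
    have hy1 : 1 - y ^ 2 = 4 * ((x ^ 2 - ρ ^ 2) * (r ^ 2 - x ^ 2)) / (r ^ 2 - ρ ^ 2) ^ 2 := by
      rw [hy]; field_simp; ring
    have hlt : 0 < 1 - y ^ 2 := by rw [hy1]; positivity
    have hd : HasDerivAt (fun x : ℝ => (2 * x ^ 2 - ρ ^ 2 - r ^ 2) / (r ^ 2 - ρ ^ 2))
        (4 * x / (r ^ 2 - ρ ^ 2)) x := by
      have := (((((hasDerivAt_pow 2 x).const_mul 2).sub_const (ρ ^ 2)).sub_const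
        (r ^ 2)).div_const (r ^ 2 - ρ ^ 2))
      convert! this using 1
      push_cast; ring
    have := (Real.hasDerivAt_arcsin (x := y) (fun h => by rw [h] at hlt; norm_num at hlt)
      (fun h => by rw [h] at hlt; norm_num at hlt)).comp x hd
    refine this.congr_deriv ?_
    have hs : Real.sqrt (1 - y ^ 2)
        = 2 * (Real.sqrt (x ^ 2 - ρ ^ 2) * Real.sqrt (r ^ 2 - x ^ 2)) / (r ^ 2 - ρ ^ 2) := by
      rw [hy1, Real.sqrt_div' _ (by positivity), Real.sqrt_sq hD.le, Real.sqrt_mul (by norm_num),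
        Real.sqrt_mul h1.le]
      congr 2
      rw [show (4 : ℝ) = 2 ^ 2 by norm_num, Real.sqrt_sq (by norm_num)]
    have p1 := Real.sqrt_pos.2 h1
    have p2 := Real.sqrt_pos.2 h2
    simp only [hs, abelKernel, hx.1, hx.2, if_true]
    field_simp
    norm_num
  · intro x hx
    have hx0 : 0 < x := hρ.1.trans hx.1
    have := abelKernel_nonneg ρ x
    have := abelKernel_nonneg x r
    positivity

theorem ae_radialMeasure_prod_mem :
    ∀ᵐ p ∂radialMeasure.prod radialMeasure, p.1 ∈ Ioo (0 : ℝ) 1 ∧ p.2 ∈ Ioo (0 : ℝ) 1 :=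
  (Measure.quasiMeasurePreserving_fst.ae ae_radialMeasure_mem).and
    (Measure.quasiMeasurePreserving_snd.ae ae_radialMeasure_mem)

theorem measurable_abelKernel_mul_abelKernel (ρ r : ℝ) :
    Measurable fun x => abelKernel ρ x * abelKernel x r :=
  (measurable_abelKernel_right ρ).mul (measurable_abelKernel_left r)

theorem integral_abelKernel_mul_abelKernel {ρ r : ℝ} (hρ : ρ ∈ Ioo (0 : ℝ) 1)
    (hr : r ∈ Ioo (0 : ℝ) 1) :
    ∫ x, abelKernel ρ x * abelKernel x r ∂radialMeasure = if ρ < r then Real.pi else 0 := by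
  rw [integral_eq_lintegral_of_nonneg_ae
    (ae_of_all _ fun x => mul_nonneg (abelKernel_nonneg _ _) (abelKernel_nonneg _ _))
    (measurable_abelKernel_mul_abelKernel ρ r).aestronglyMeasurable,
    lintegral_abelKernel_mul_abelKernel hρ hr, ENNReal.toReal_ofReal]
  split_ifs <;> positivity

/-- The factorization of integration into two Abel transforms: pairing the Abel transform of `g`
with the adjoint Abel transform of `d` is `π` times pairing `g` with the primitive of `d`. -/
theorem integral_abel_mul_adjoint {g d : ℝ → ℝ} (hg : Measurable g) (hd : Measurable d) {A B : ℝ}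
    (hgA : ∀ r ∈ Ioo (0 : ℝ) 1, |g r| ≤ A) (hdB : ∀ r ∈ Ioo (0 : ℝ) 1, |d r| ≤ B) :
    ∫ x, (∫ r, abelKernel x r * g r ∂radialMeasure) *
        (∫ ρ, abelKernel ρ x * d ρ ∂radialMeasure) ∂radialMeasure =
      Real.pi * ∫ r, g r * (∫ ρ, (if ρ < r then d ρ else 0) ∂radialMeasure) ∂radialMeasure := by
  have hA : 0 ≤ A := (abs_nonneg _).trans (hgA (1 / 2) (by norm_num))
  have hB : 0 ≤ B := (abs_nonneg _).trans (hdB (1 / 2) (by norm_num))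
  let T : ℝ → ℝ × ℝ → ℝ := fun x p => (abelKernel x p.1 * g p.1) * (abelKernel p.2 x * d p.2)
  have hT : Measurable (Function.uncurry T) := by
    refine Measurable.mul (Measurable.mul ?_ (hg.comp (by fun_prop)))
      (Measurable.mul ?_ (hd.comp (by fun_prop)))
    · exact measurable_abelKernel.comp
        (f := fun q : ℝ × ℝ × ℝ => (q.1, q.2.1)) (by fun_prop)
    · exact measurable_abelKernel.comp
        (f := fun q : ℝ × ℝ × ℝ => (q.2.2, q.1)) (by fun_prop)
  -- the singularities of the kernels are integrated out first, in `x`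
  have hTint : Integrable (Function.uncurry T)
      (radialMeasure.prod (radialMeasure.prod radialMeasure)) := by
    refine ⟨hT.aestronglyMeasurable, ?_⟩
    rw [HasFiniteIntegral, lintegral_prod_symm _ hT.enorm.aemeasurable]
    calc ∫⁻ p, ∫⁻ x, ‖Function.uncurry T (x, p)‖ₑ ∂radialMeasure
            ∂(radialMeasure.prod radialMeasure)
        ≤ ∫⁻ _, ENNReal.ofReal (A * B) * ENNReal.ofReal Real.pi
            ∂(radialMeasure.prod radialMeasure) := by
          apply lintegral_mono_ae
          filter_upwards [ae_radialMeasure_prod_mem] with p hp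
          calc ∫⁻ x, ‖Function.uncurry T (x, p)‖ₑ ∂radialMeasure
              ≤ ∫⁻ x, ENNReal.ofReal (A * B) *
                  ENNReal.ofReal (abelKernel p.2 x * abelKernel x p.1) ∂radialMeasure := by
                refine lintegral_mono fun x => ?_
                rw [← ENNReal.ofReal_mul (by positivity), Real.enorm_eq_ofReal_abs]
                apply ENNReal.ofReal_le_ofReal
                simp only [Function.uncurry, T, abs_mul, abs_of_nonneg (abelKernel_nonneg _ _)]
                have h1 := abelKernel_nonneg p.2 x
                have h2 := abelKernel_nonneg x p.1
                have h3 : |g p.1| * |d p.2| ≤ A * B :=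
                  mul_le_mul (hgA _ hp.1) (hdB _ hp.2) (abs_nonneg _) hA
                calc _ = (|g p.1| * |d p.2|) * (abelKernel p.2 x * abelKernel x p.1) := by ring
                  _ ≤ _ := by gcongr
            _ ≤ _ := by
                rw [lintegral_const_mul _ (measurable_abelKernel_mul_abelKernel _ _).ennreal_ofReal,
                  lintegral_abelKernel_mul_abelKernel hp.2 hp.1]
                gcongr
                split_ifs
                · exact le_rfl
                · positivity
      _ < ∞ := by
          rw [lintegral_const]
          exact ENNReal.mul_lt_top (by finiteness) (measure_lt_top _ _)
  let S : ℝ × ℝ → ℝ := fun p => Real.pi * (g p.1 * (if p.2 < p.1 then d p.2 else 0))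
  have hlt : MeasurableSet {p : ℝ × ℝ | p.2 < p.1} :=
    measurableSet_lt measurable_snd measurable_fst
  have hS : Measurable S :=
    measurable_const.mul ((hg.comp measurable_fst).mul
      (Measurable.ite hlt (hd.comp measurable_snd) measurable_const))
  have hSint : Integrable S (radialMeasure.prod radialMeasure) := by
    refine Integrable.of_bound hS.aestronglyMeasurable (Real.pi * (A * B)) ?_
    filter_upwards [ae_radialMeasure_prod_mem] with p hp
    simp only [S, norm_mul, Real.norm_eq_abs, abs_of_pos Real.pi_pos]
    gcongr
    · exact hgA _ hp.1
    · split_ifs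
      · exact hdB _ hp.2
      · simpa using hB
  calc _ = ∫ x, ∫ p, T x p ∂(radialMeasure.prod radialMeasure) ∂radialMeasure := by
        refine integral_congr_ae (ae_of_all _ fun x => ?_)
        exact (integral_prod_mul (fun r => abelKernel x r * g r)
          (fun ρ => abelKernel ρ x * d ρ)).symm
    _ = ∫ p, ∫ x, T x p ∂radialMeasure ∂(radialMeasure.prod radialMeasure) :=
        integral_integral_swap hTint
    _ = ∫ p, S p ∂(radialMeasure.prod radialMeasure) := by
        refine integral_congr_ae ?_
        filter_upwards [ae_radialMeasure_prod_mem] with p hp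
        have : ∀ x, T x p = (g p.1 * d p.2) * (abelKernel p.2 x * abelKernel x p.1) := by
          intro x; simp only [T]; ring
        simp only [this, S]
        rw [integral_const_mul, integral_abelKernel_mul_abelKernel hp.2 hp.1]
        split_ifs <;> ring
    _ = _ := by
        rw [integral_prod _ hSint]
        simp only [S]
        rw [← integral_const_mul]
        refine integral_congr_ae (ae_of_all _ fun r => ?_)
        simp only [integral_const_mul]

/-! ### Exponential smoothing in the variable `r²` -/

/-- The primitive in the first variable of a `C¹` function of two variables is `C¹`. -/
theorem contDiff_primitive_fst {K : ℝ × ℝ → ℝ} (hK : ContDiff ℝ 1 K) :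
    ContDiff ℝ 1 fun p : ℝ × ℝ => ∫ t in (0 : ℝ)..p.1, K (t, p.2) := by
  let D : ℝ × ℝ → ℝ := fun q => fderiv ℝ K q (0, 1)
  have hD : Continuous D := (hK.continuous_fderiv one_ne_zero).clm_apply continuous_const
  have hprim (G : ℝ × ℝ → ℝ) (hG : Continuous G) :
      Continuous fun p : ℝ × ℝ => ∫ t in (0 : ℝ)..p.1, G (t, p.2) := by
    apply intervalIntegral.continuous_parametric_intervalIntegral_of_continuous
      (f := fun (p : ℝ × ℝ) t => G (t, p.2)) _ continuous_fst
    exact hG.comp (by fun_prop)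
  let f : ℝ → ℝ → ℝ := fun r z => ∫ t in (0 : ℝ)..r, K (t, z)
  let f₁ : ℝ → ℝ → ℝ →L[ℝ] ℝ := fun r z => K (r, z) • ContinuousLinearMap.id ℝ ℝ
  let f₂ : ℝ → ℝ → ℝ →L[ℝ] ℝ := fun r z =>
    (∫ t in (0 : ℝ)..r, D (t, z)) • ContinuousLinearMap.id ℝ ℝ
  have c₁ : Continuous fun p : ℝ × ℝ => f₁ p.1 p.2 := hK.continuous.smul continuous_const
  have c₂ : Continuous fun p : ℝ × ℝ => f₂ p.1 p.2 := (hprim D hD).smul continuous_const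
  have d₁ (p : ℝ × ℝ) : HasFDerivAt (fun r => f r p.2) (f₁ p.1 p.2) p.1 := by
    have hc : Continuous fun t => K (t, p.2) := hK.continuous.comp (by fun_prop)
    have := (intervalIntegral.integral_hasDerivAt_right (hc.intervalIntegrable 0 p.1)
      (hc.stronglyMeasurableAtFilter _ _) hc.continuousAt).hasFDerivAt
    convert! this using 1
    ext; simp [f₁]
  have d₂ (p : ℝ × ℝ) : HasFDerivAt (fun z => f p.1 z) (f₂ p.1 p.2) p.2 := by
    obtain ⟨B, hB⟩ := (isCompact_uIcc (a := 0) (b := p.1)).prod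
      (isCompact_closedBall p.2 1) |>.exists_bound_of_continuousOn hD.continuousOn
    have := (intervalIntegral.hasDerivAt_integral_of_dominated_loc_of_deriv_le
      (μ := volume) (a := 0) (b := p.1) (F := fun z t => K (t, z)) (F' := fun z t => D (t, z))
      (x₀ := p.2) (bound := fun _ => B) (Metric.closedBall_mem_nhds p.2 one_pos)
      (Filter.Eventually.of_forall fun z =>
        (hK.continuous.comp (by fun_prop : Continuous fun t : ℝ => (t, z))).aestronglyMeasurable)
      ((hK.continuous.comp (by fun_prop : Continuous fun t : ℝ => (t, p.2))).intervalIntegrable _ _)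
      (hD.comp (by fun_prop : Continuous fun t : ℝ => (t, p.2))).aestronglyMeasurable
      (ae_of_all _ fun t ht z hz => hB (t, z) ⟨uIoc_subset_uIcc ht, hz⟩)
      (by simp)
      (ae_of_all _ fun t _ z _ => by
        have h1 : HasDerivAt (fun z : ℝ => (t, z)) ((0 : ℝ), (1 : ℝ)) z :=
          (hasDerivAt_const z t).prodMk (hasDerivAt_id z)
        exact ((hK.differentiable one_ne_zero (t, z)).hasFDerivAt).comp_hasDerivAt z h1)).2
    convert! this.hasFDerivAt using 1
    ext; simp [f₂]
  refine contDiff_one_iff_hasFDerivAt.2 ⟨fun p => (f₁ p.1 p.2).coprod (f₂ p.1 p.2), ?_, fun p => ?_⟩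
  · have : (fun p : ℝ × ℝ => (f₁ p.1 p.2).coprod (f₂ p.1 p.2)) = fun p =>
        (f₁ p.1 p.2).comp (ContinuousLinearMap.fst ℝ ℝ ℝ) +
          (f₂ p.1 p.2).comp (ContinuousLinearMap.snd ℝ ℝ ℝ) := by
      ext p <;> simp
    rw [this]
    exact (c₁.clm_comp continuous_const).add (c₂.clm_comp continuous_const)
  · exact (hasStrictFDerivAt_uncurry_coprod (f := f) (f₁ := f₁) (f₂ := f₂)
      (Filter.Eventually.of_forall d₁) (Filter.Eventually.of_forall d₂)
      c₁.continuousAt c₂.continuousAt).hasFDerivAt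

/-- Exponential averaging of `ψ(·, z)` over scale `h` in the variable `s = r²`: the solution `η` of
`η + h ∂_s η = ψ` that vanishes at `r = 0`. -/
def radialSmoothing (h : ℝ) (ψ : ℝ × ℝ → ℝ) (p : ℝ × ℝ) : ℝ :=
  Real.exp (-(p.1 ^ 2 / h)) *
    ∫ t in (0 : ℝ)..p.1, Real.exp (t ^ 2 / h) * (2 * t / h) * ψ (t, p.2)

theorem contDiff_radialSmoothing (h : ℝ) {ψ : ℝ × ℝ → ℝ} (hψ : ContDiff ℝ 1 ψ) :
    ContDiff ℝ 1 (radialSmoothing h ψ) := by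
  refine ContDiff.mul (by fun_prop) (contDiff_primitive_fst
    (K := fun q => Real.exp (q.1 ^ 2 / h) * (2 * q.1 / h) * ψ q) ?_)
  fun_prop

theorem hasDerivAt_radialSmoothing (h : ℝ) {ψ : ℝ × ℝ → ℝ} (hψ : Continuous ψ)
    (r z : ℝ) : HasDerivAt (fun r => radialSmoothing h ψ (r, z))
      (2 * r / h * (ψ (r, z) - radialSmoothing h ψ (r, z))) r := by
  have hc : Continuous fun t => Real.exp (t ^ 2 / h) * (2 * t / h) * ψ (t, z) := by fun_prop
  have h1 := intervalIntegral.integral_hasDerivAt_right (hc.intervalIntegrable 0 r)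
      (hc.stronglyMeasurableAtFilter _ _) hc.continuousAt
  have h2 : HasDerivAt (fun r : ℝ => Real.exp (-(r ^ 2 / h)))
      (Real.exp (-(r ^ 2 / h)) * -(2 * r / h)) r := by
    have := (((hasDerivAt_pow 2 r).div_const h).neg).exp
    simpa using this
  refine (h2.mul h1).congr_deriv ?_
  have h3 : Real.exp (-(r ^ 2 / h)) * Real.exp (r ^ 2 / h) = 1 := by
    rw [← Real.exp_add]; simp
  simp only [radialSmoothing]
  linear_combination (2 * r / h * ψ (r, z)) * h3

theorem radialSmoothing_zero_fst (h : ℝ) (ψ : ℝ × ℝ → ℝ) (z : ℝ) :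
    radialSmoothing h ψ (0, z) = 0 := by simp [radialSmoothing]

/-- Exponential smoothing is an average, so it does not increase the supremum. -/
theorem abs_radialSmoothing_le {h : ℝ} (hh : 0 < h) {ψ : ℝ × ℝ → ℝ}
    {M : ℝ} (hM : ∀ p, |ψ p| ≤ M) {r : ℝ} (hr : 0 ≤ r) (z : ℝ) :
    |radialSmoothing h ψ (r, z)| ≤ M := by
  have hM0 : 0 ≤ M := (abs_nonneg _).trans (hM 0)
  have hexp : ∀ t : ℝ, HasDerivAt (fun t => Real.exp (t ^ 2 / h))
      (Real.exp (t ^ 2 / h) * (2 * t / h)) t := fun t => by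
    simpa using ((hasDerivAt_pow 2 t).div_const h).exp
  have hint : ∫ t in (0 : ℝ)..r, Real.exp (t ^ 2 / h) * (2 * t / h) =
      Real.exp (r ^ 2 / h) - 1 := by
    rw [intervalIntegral.integral_eq_sub_of_hasDerivAt (fun t _ => hexp t)
      (Continuous.intervalIntegrable (by fun_prop) _ _)]
    simp
  have h1 : |∫ t in (0 : ℝ)..r, Real.exp (t ^ 2 / h) * (2 * t / h) * ψ (t, z)| ≤
      M * (Real.exp (r ^ 2 / h) - 1) := by
    rw [← hint, ← intervalIntegral.integral_const_mul, ← Real.norm_eq_abs]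
    refine intervalIntegral.norm_integral_le_of_norm_le hr (ae_of_all _ fun t ht => ?_)
      (Continuous.intervalIntegrable (by fun_prop) _ _)
    have : 0 ≤ Real.exp (t ^ 2 / h) * (2 * t / h) := by
      have := ht.1; positivity
    rw [norm_mul, Real.norm_of_nonneg this, mul_comm]
    exact mul_le_mul_of_nonneg_right (hM _) this
  simp only [radialSmoothing, abs_mul, abs_of_pos (Real.exp_pos _)]
  calc _ ≤ Real.exp (-(r ^ 2 / h)) * (M * (Real.exp (r ^ 2 / h) - 1)) := by gcongr
    _ = M * (1 - Real.exp (-(r ^ 2 / h))) := by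
        have h3 : Real.exp (-(r ^ 2 / h)) * Real.exp (r ^ 2 / h) = 1 := by
          rw [← Real.exp_add]; simp
        linear_combination M * h3
    _ ≤ M := by nlinarith [Real.exp_pos (-(r ^ 2 / h))]

theorem radialSmoothing_eq_zero (h : ℝ) {ψ : ℝ × ℝ → ℝ} {r z : ℝ}
    (hψ : ∀ t ∈ Set.uIcc 0 r, ψ (t, z) = 0) : radialSmoothing h ψ (r, z) = 0 := by
  rw [radialSmoothing, intervalIntegral.integral_congr (g := fun _ => 0)]
  · simp
  · intro t ht
    simp [hψ t ht]

/-- `η` is the primitive of `(ψ - η) / h` with respect to `radialMeasure`. -/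
theorem integral_sub_radialSmoothing {h : ℝ} (hh : 0 < h) {ψ : ℝ × ℝ → ℝ} (hψ : ContDiff ℝ 1 ψ)
    {r : ℝ} (hr : r ∈ Ioo (0 : ℝ) 1) (z : ℝ) :
    ∫ ρ, (if ρ < r then ψ (ρ, z) - radialSmoothing h ψ (ρ, z) else 0) ∂radialMeasure =
      h * radialSmoothing h ψ (r, z) := by
  have hη := (contDiff_radialSmoothing h hψ).continuous
  have hψc := hψ.continuous
  rw [integral_radialMeasure]
  have hFTC := intervalIntegral.integral_eq_sub_of_hasDerivAt (a := 0) (b := r)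
    (fun t _ => hasDerivAt_radialSmoothing h hψc t z)
    (Continuous.intervalIntegrable (by fun_prop) _ _)
  rw [radialSmoothing_zero_fst, sub_zero] at hFTC
  rw [← hFTC, ← intervalIntegral.integral_const_mul, intervalIntegral.integral_of_le hr.1.le,
    integral_Ioc_eq_integral_Ioo, ← integral_indicator measurableSet_Ioo,
    ← integral_indicator measurableSet_Ioo]
  congr 1
  ext t
  by_cases h1 : t ∈ Ioo 0 r
  · rw [indicator_of_mem h1, indicator_of_mem (show t ∈ Ioo (0 : ℝ) 1 from ⟨h1.1, h1.2.trans hr.2⟩),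
      if_pos h1.2]
    field_simp
  · rw [indicator_of_notMem h1]
    by_cases h2 : t ∈ Ioo (0 : ℝ) 1
    · rw [indicator_of_mem h2, if_neg (fun h3 => h1 ⟨h2.1, h3⟩), mul_zero]
    · rw [indicator_of_notMem h2]

/-- The energy estimate for `η + h ∂_s η = ψ`: multiplying by `η` and integrating gives
`∫ (ψ - η) η ≥ 0`, whence `ψ - η` is no larger than `ψ` in `L²`. -/
theorem integral_sq_sub_radialSmoothing_le {h : ℝ} (hh : 0 < h) {ψ : ℝ × ℝ → ℝ}
    (hψ : ContDiff ℝ 1 ψ) (z : ℝ) :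
    ∫ r, (ψ (r, z) - radialSmoothing h ψ (r, z)) ^ 2 ∂radialMeasure ≤
      ∫ r, ψ (r, z) ^ 2 ∂radialMeasure := by
  have hη := (contDiff_radialSmoothing h hψ).continuous
  have hψc := hψ.continuous
  set η : ℝ → ℝ := fun r => radialSmoothing h ψ (r, z) with hηdef
  have hηc : Continuous η := by fun_prop
  have hd := hasDerivAt_radialSmoothing h hψc
  simp only [integral_radialMeasure, ← integral_Ioc_eq_integral_Ioo]
  rw [← intervalIntegral.integral_of_le zero_le_one, ← intervalIntegral.integral_of_le zero_le_one]
  have hE : ∫ r in (0 : ℝ)..1, 2 * r * ((ψ (r, z) - η r) * η r) = h / 2 * η 1 ^ 2 := by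
    have hFTC := intervalIntegral.integral_eq_sub_of_hasDerivAt (a := 0) (b := 1)
      (f := fun r => h / 2 * η r ^ 2) (f' := fun r => 2 * r * ((ψ (r, z) - η r) * η r))
      (fun t _ => by
        refine (((hd t z).pow 2).const_mul (h / 2)).congr_deriv ?_
        simp only [hηdef]
        push_cast; field_simp)
      (Continuous.intervalIntegrable (by fun_prop) _ _)
    rw [hFTC]
    simp [hηdef, radialSmoothing_zero_fst]
  have hsplit : ∫ r in (0 : ℝ)..1, 2 * r * ψ (r, z) ^ 2 =
      (∫ r in (0 : ℝ)..1, 2 * r * (ψ (r, z) - η r) ^ 2) +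
      (∫ r in (0 : ℝ)..1, 2 * r * η r ^ 2) +
      2 * ∫ r in (0 : ℝ)..1, 2 * r * ((ψ (r, z) - η r) * η r) := by
    rw [← intervalIntegral.integral_const_mul, ← intervalIntegral.integral_add,
      ← intervalIntegral.integral_add]
    · congr 1; ext r; ring
    all_goals exact Continuous.intervalIntegrable (by fun_prop) _ _
  have hpos : 0 ≤ ∫ r in (0 : ℝ)..1, 2 * r * η r ^ 2 :=
    intervalIntegral.integral_nonneg zero_le_one fun r hr => by have := hr.1; positivity
  rw [hsplit, hE]
  have : 0 ≤ h / 2 * η 1 ^ 2 := by positivity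
  linarith

/-! ### Testing the total variation -/

theorem interior_Omega : interior Omega = Ioo 0 1 ×ˢ Ioo (-1) 1 := by
  rw [Omega, interior_prod_eq, interior_Icc, interior_Icc]

theorem totalVariation_congr_ae {v w : ℝ × ℝ → ℝ} {W : Set (ℝ × ℝ)}
    (h : v =ᵐ[volume.restrict W] w) : totalVariation v W = totalVariation w W := by
  unfold totalVariation
  refine iSup_congr fun φ => iSup_congr fun _ => congrArg _ (integral_congr_ae ?_)
  filter_upwards [h] with p hp
  rw [hp]

theorem IsTestField.integral_le {v : ℝ × ℝ → ℝ} {W : Set (ℝ × ℝ)}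
    {φ : ℝ × ℝ → EuclideanSpace ℝ (Fin 2)} (hφ : IsTestField W φ) (hv : totalVariation v W ≠ ∞) :
    ∫ p in W, v p * divergence φ p ≤ (totalVariation v W).toReal := by
  rw [← ENNReal.ofReal_le_iff_le_toReal hv]
  exact le_iSup₂ (f := fun (φ : ℝ × ℝ → EuclideanSpace ℝ (Fin 2)) (_ : IsTestField W φ) =>
    ENNReal.ofReal (∫ p in W, v p * divergence φ p)) φ hφ

/-- A horizontal field with a scalar factor `G` has divergence `∂_r G`. -/
theorem divergence_smul_single {G : ℝ × ℝ → ℝ} {p : ℝ × ℝ} (hG : DifferentiableAt ℝ G p) :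
    divergence (fun q => G q • EuclideanSpace.single (0 : Fin 2) (1 : ℝ)) p =
      fderiv ℝ G p (1, 0) := by
  simp [divergence, fderiv_smul_const hG]

/-- The weighted measure `2r dr dz` on the open rectangle. -/
def cylMeasure : Measure (ℝ × ℝ) := radialMeasure.prod (volume.restrict (Ioo (-1) 1))

theorem cylMeasure_eq_withDensity :
    cylMeasure = (volume.restrict (interior Omega)).withDensity
      fun p => ENNReal.ofReal (2 * p.1) := by
  rw [cylMeasure, radialMeasure, prod_withDensity_left measurable_radialDensity,
    Measure.prod_restrict, interior_Omega, ← Measure.volume_eq_prod]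

instance : IsFiniteMeasure cylMeasure := by unfold cylMeasure; infer_instance

theorem integral_cylMeasure (F : ℝ × ℝ → ℝ) :
    ∫ p, F p ∂cylMeasure = ∫ p in interior Omega, 2 * p.1 * F p := by
  rw [cylMeasure_eq_withDensity, integral_withDensity_eq_integral_toReal_smul (by fun_prop)
    (ae_of_all _ fun _ => ENNReal.ofReal_lt_top)]
  refine setIntegral_congr_fun isOpen_interior.measurableSet fun p hp => ?_
  rw [interior_Omega] at hp
  have : 0 ≤ 2 * p.1 := by linarith [hp.1.1]
  simp only [ENNReal.toReal_ofReal this, smul_eq_mul]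

/-- The part `ψ - η = h ∂_s η` lost by smoothing is controlled by the total variation: `η / M`, cut
off near `r = 1` where `v` vanishes, is the first component of an admissible test field. -/
theorem integral_mul_sub_radialSmoothing_le {v ψ : ℝ × ℝ → ℝ} {h M β a b c d : ℝ} (hh : 0 < h)
    (hM : 0 < M) (hβ : β < 1) (hv : ∀ p : ℝ × ℝ, β ≤ p.1 → v p = 0)
    (hTV : totalVariation v (interior Omega) ≠ ∞) (hψ : ContDiff ℝ 1 ψ)
    (hψM : ∀ p, |ψ p| ≤ M) (ha : 0 < a) (hc : -1 < c) (hd : d < 1)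
    (hψ0 : ∀ p ∉ Icc a b ×ˢ Icc c d, ψ p = 0) :
    ∫ p, v p * (ψ p - radialSmoothing h ψ p) ∂cylMeasure ≤
      h * M * (totalVariation v (interior Omega)).toReal := by
  have hη := contDiff_radialSmoothing h hψ
  have hη0 : ∀ p : ℝ × ℝ, (p.1 < a ∨ p.2 ∉ Icc c d) → radialSmoothing h ψ p = 0 := by
    rintro ⟨r, z⟩ hp
    refine radialSmoothing_eq_zero h fun t ht => hψ0 _ fun hmem => ?_
    rcases hp with hp | hp
    · have h1 : t ≤ max 0 r := ht.2
      have h2 : max 0 r < a := max_lt ha hp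
      exact absurd hmem.1.1 (not_le.2 (h1.trans_lt h2))
    · exact hp hmem.2
  obtain ⟨γ, hβγ, hγ⟩ := exists_between hβ
  have hγβ : 0 < γ - β := sub_pos.2 hβγ
  set χ : ℝ → ℝ := fun r => Real.smoothTransition ((γ - r) / (γ - β)) with hχ
  have hχd : ContDiff ℝ 1 χ :=
    Real.smoothTransition.contDiff.comp ((contDiff_const.sub contDiff_id).div_const _)
  set G : ℝ × ℝ → ℝ := fun p => χ p.1 * (radialSmoothing h ψ p / M) with hG
  have hGd : ContDiff ℝ 1 G := (hχd.comp contDiff_fst).mul (hη.div_const _)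
  have hGsupp : ∀ p ∉ Icc a γ ×ˢ Icc c d, G p = 0 := by
    intro p hp
    by_cases h1 : p.1 < a ∨ p.2 ∉ Icc c d
    · simp [hG, hη0 p h1]
    · push Not at h1
      have h2 : γ < p.1 := by
        by_contra h2
        exact hp ⟨⟨h1.1, not_lt.1 h2⟩, h1.2⟩
      have : χ p.1 = 0 := Real.smoothTransition.zero_of_nonpos
        (div_nonpos_of_nonpos_of_nonneg (by linarith) hγβ.le)
      simp [hG, this]
  have hcomp : IsCompact (Icc a γ ×ˢ Icc c d) := isCompact_Icc.prod isCompact_Icc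
  have hsub : tsupport (fun q => G q • EuclideanSpace.single (0 : Fin 2) (1 : ℝ)) ⊆
      Icc a γ ×ˢ Icc c d := by
    refine closure_minimal (fun p hp => ?_) hcomp.isClosed
    by_contra hmem
    exact hp (by simp [hGsupp p hmem])
  have htest : IsTestField (interior Omega)
      (fun q => G q • EuclideanSpace.single (0 : Fin 2) (1 : ℝ)) := by
    refine ⟨hGd.smul contDiff_const, hcomp.of_isClosed_subset (isClosed_tsupport _) hsub,
      hsub.trans ?_, fun p => ?_⟩
    · rw [interior_Omega]
      exact prod_mono (fun r hr => ⟨ha.trans_le hr.1, hr.2.trans_lt hγ⟩)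
        (fun z hz => ⟨hc.trans_le hz.1, hz.2.trans_lt hd⟩)
    · rw [norm_smul, PiLp.norm_single, norm_one, mul_one, Real.norm_eq_abs]
      by_cases h1 : p.1 < a
      · simp [hG, hη0 p (Or.inl h1)]
      · have hle := abs_radialSmoothing_le hh hψM (ha.le.trans (not_lt.1 h1)) p.2
        rw [hG, abs_mul, abs_div, abs_of_pos hM, abs_of_nonneg (Real.smoothTransition.nonneg _)]
        exact mul_le_one₀ (Real.smoothTransition.le_one _) (by positivity)
          ((div_le_one hM).2 hle)
  have hdiv : ∀ p : ℝ × ℝ, p.1 < β →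
      divergence (fun q => G q • EuclideanSpace.single (0 : Fin 2) (1 : ℝ)) p =
        2 * p.1 / h * (ψ p - radialSmoothing h ψ p) / M := by
    intro p hp
    rw [divergence_smul_single (hGd.differentiable one_ne_zero p)]
    have h1 : HasDerivAt (fun r : ℝ => G (r, p.2)) (fderiv ℝ G p (1, 0)) p.1 :=
      HasFDerivAt.comp_hasDerivAt (f := fun r : ℝ => (r, p.2)) p.1
        (hGd.differentiable one_ne_zero p).hasFDerivAt ((hasDerivAt_id' p.1).prodMk (hasDerivAt_const p.1 p.2))
    have h2 := (hasDerivAt_radialSmoothing h hψ.continuous p.1 p.2).div_const M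
    refine h1.unique (h2.congr_of_eventuallyEq ?_)
    filter_upwards [Iio_mem_nhds hp] with r hr
    have : χ r = 1 := Real.smoothTransition.one_of_one_le
      ((one_le_div hγβ).2 (by linarith [mem_Iio.1 hr]))
    simp [hG, this]
  have hle := htest.integral_le hTV
  calc ∫ p, v p * (ψ p - radialSmoothing h ψ p) ∂cylMeasure
      = ∫ p in interior Omega, h * M * (v p *
          divergence (fun q => G q • EuclideanSpace.single (0 : Fin 2) (1 : ℝ)) p) := by
        rw [integral_cylMeasure]
        congr 1
        ext p
        rcases le_or_gt β p.1 with h1 | h1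
        · simp [hv p h1]
        · rw [hdiv p h1]; field_simp
    _ ≤ _ := by
        rw [integral_const_mul]
        gcongr

/-! ### Pairing with the Abel transform -/

theorem integrable_of_lintegral_ofReal_le {g : ℝ → ℝ} (hg : Measurable g) (hg0 : ∀ x, 0 ≤ g x)
    (h : ∫⁻ x, ENNReal.ofReal (g x) ∂radialMeasure ≤ 2) :
    Integrable g radialMeasure ∧ ∫ x, g x ∂radialMeasure ≤ 2 := by
  have hint : Integrable g radialMeasure := by
    refine ⟨hg.aestronglyMeasurable, ?_⟩
    rw [hasFiniteIntegral_iff_ofReal (ae_of_all _ hg0)]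
    exact h.trans_lt (by norm_num)
  refine ⟨hint, ?_⟩
  rw [← ENNReal.ofReal_le_ofReal_iff zero_le_two,
    ofReal_integral_eq_lintegral_ofReal hint (ae_of_all _ hg0)]
  exact h.trans_eq (by simp)

theorem norm_integral_kernel_mul_le {k g : ℝ → ℝ} {A : ℝ} (hk : Measurable k)
    (hk0 : ∀ x, 0 ≤ k x) (hk2 : ∫⁻ x, ENNReal.ofReal (k x) ∂radialMeasure ≤ 2)
    (hA : 0 ≤ A) (hgA : ∀ r ∈ Ioo (0 : ℝ) 1, |g r| ≤ A) :
    ‖∫ r, k r * g r ∂radialMeasure‖ ≤ 2 * A := by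
  obtain ⟨h1, h2⟩ := integrable_of_lintegral_ofReal_le hk hk0 hk2
  refine (norm_integral_le_of_norm_le (g := fun r => k r * A) (h1.mul_const A) ?_).trans ?_
  · filter_upwards [ae_radialMeasure_mem] with r hr
    rw [norm_mul, Real.norm_of_nonneg (hk0 r)]
    exact mul_le_mul_of_nonneg_left (hgA r hr) (hk0 r)
  · rw [integral_mul_const]
    gcongr

/-- The Abel transform in the first variable, as an integral against `abelKernel`. -/
def kernelAbel (v : ℝ × ℝ → ℝ) (p : ℝ × ℝ) : ℝ :=
  ∫ r, abelKernel p.1 r * v (r, p.2) ∂radialMeasure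

/-- The adjoint of `kernelAbel` with respect to `radialMeasure`. -/
def kernelAbelAdjoint (d : ℝ × ℝ → ℝ) (p : ℝ × ℝ) : ℝ :=
  ∫ ρ, abelKernel ρ p.1 * d (ρ, p.2) ∂radialMeasure

theorem measurable_kernelAbel {v : ℝ × ℝ → ℝ} (hv : Measurable v) : Measurable (kernelAbel v) := by
  refine (StronglyMeasurable.integral_prod_right
    (f := fun (p : ℝ × ℝ) r => abelKernel p.1 r * v (r, p.2)) ?_).measurable
  refine (Measurable.mul ?_ (hv.comp (by fun_prop))).stronglyMeasurable
  exact measurable_abelKernel.comp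
    (f := fun q : (ℝ × ℝ) × ℝ => (q.1.1, q.2)) (by fun_prop)

theorem measurable_kernelAbelAdjoint {d : ℝ × ℝ → ℝ} (hd : Measurable d) :
    Measurable (kernelAbelAdjoint d) := by
  refine (StronglyMeasurable.integral_prod_right
    (f := fun (p : ℝ × ℝ) ρ => abelKernel ρ p.1 * d (ρ, p.2)) ?_).measurable
  refine (Measurable.mul ?_ (hd.comp (by fun_prop))).stronglyMeasurable
  exact measurable_abelKernel.comp
    (f := fun q : (ℝ × ℝ) × ℝ => (q.2, q.1.1)) (by fun_prop)

theorem norm_kernelAbel_le {v : ℝ × ℝ → ℝ} {A : ℝ} (hA : 0 ≤ A)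
    (hvA : ∀ p : ℝ × ℝ, p.1 ∈ Ioo (0 : ℝ) 1 → |v p| ≤ A) {p : ℝ × ℝ} (hp : p.1 ∈ Ioo (0 : ℝ) 1) :
    ‖kernelAbel v p‖ ≤ 2 * A :=
  norm_integral_kernel_mul_le (measurable_abelKernel_right _) (abelKernel_nonneg _)
    (lintegral_abelKernel_right_le hp) hA fun _ hr => hvA _ hr

theorem norm_kernelAbelAdjoint_le {d : ℝ × ℝ → ℝ} {A : ℝ} (hA : 0 ≤ A)
    (hdA : ∀ p : ℝ × ℝ, p.1 ∈ Ioo (0 : ℝ) 1 → |d p| ≤ A) {p : ℝ × ℝ} (hp : p.1 ∈ Ioo (0 : ℝ) 1) :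
    ‖kernelAbelAdjoint d p‖ ≤ 2 * A :=
  norm_integral_kernel_mul_le (measurable_abelKernel_left _) (fun _ => abelKernel_nonneg _ _)
    (lintegral_abelKernel_left_le hp) hA fun _ hr => hdA _ hr

theorem ae_cylMeasure_fst_mem : ∀ᵐ p ∂cylMeasure, p.1 ∈ Ioo (0 : ℝ) 1 :=
  Measure.quasiMeasurePreserving_fst.ae ae_radialMeasure_mem

theorem integrable_cylMeasure_of_bound {F : ℝ × ℝ → ℝ} (hF : Measurable F) {B : ℝ}
    (hB : ∀ p : ℝ × ℝ, p.1 ∈ Ioo (0 : ℝ) 1 → |F p| ≤ B) : Integrable F cylMeasure :=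
  Integrable.of_bound hF.aestronglyMeasurable B (ae_cylMeasure_fst_mem.mono fun p hp => hB p hp)

theorem integrable_radialMeasure_of_bound {F : ℝ → ℝ} (hF : Measurable F) {B : ℝ}
    (hB : ∀ r ∈ Ioo (0 : ℝ) 1, |F r| ≤ B) : Integrable F radialMeasure :=
  Integrable.of_bound hF.aestronglyMeasurable B (ae_radialMeasure_mem.mono fun p hp => hB p hp)

theorem integral_cylMeasure_symm {F : ℝ × ℝ → ℝ} (hF : Integrable F cylMeasure) :
    ∫ p, F p ∂cylMeasure = ∫ z in Ioo (-1) 1, ∫ r, F (r, z) ∂radialMeasure :=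
  integral_prod_symm _ hF

/-- The adjoint Abel transform is bounded by `2` on `L²(2r dr)`, by Schur's test. -/
theorem integral_sq_kernelAbelAdjoint_le {d : ℝ × ℝ → ℝ} (hd : Measurable d) {A : ℝ} (hA : 0 ≤ A)
    (hdA : ∀ p : ℝ × ℝ, p.1 ∈ Ioo (0 : ℝ) 1 → |d p| ≤ A) (z : ℝ) :
    ∫ x, kernelAbelAdjoint d (x, z) ^ 2 ∂radialMeasure ≤
      4 * ∫ ρ, d (ρ, z) ^ 2 ∂radialMeasure := by
  have hdz : Measurable fun ρ => d (ρ, z) := hd.comp measurable_prodMk_right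
  have hI : Integrable (fun ρ => d (ρ, z) ^ 2) radialMeasure :=
    integrable_radialMeasure_of_bound (hdz.pow_const 2) (B := A ^ 2) fun r hr => by
      rw [abs_pow]; exact pow_le_pow_left₀ (abs_nonneg _) (hdA (r, z) hr) 2
  have hZ : Integrable (fun x => kernelAbelAdjoint d (x, z) ^ 2) radialMeasure :=
    integrable_radialMeasure_of_bound
      (((measurable_kernelAbelAdjoint hd).comp measurable_prodMk_right).pow_const 2)
      (B := (2 * A) ^ 2) fun r hr => by
        rw [abs_pow]
        exact pow_le_pow_left₀ (abs_nonneg _) (norm_kernelAbelAdjoint_le hA hdA (p := (r, z)) hr) 2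
  have hpos : 0 ≤ ∫ ρ, d (ρ, z) ^ 2 ∂radialMeasure := integral_nonneg fun _ => sq_nonneg _
  rw [← ENNReal.ofReal_le_ofReal_iff (by positivity), ENNReal.ofReal_mul (by norm_num),
    ofReal_integral_eq_lintegral_ofReal hZ (ae_of_all _ fun _ => sq_nonneg _),
    ofReal_integral_eq_lintegral_ofReal hI (ae_of_all _ fun _ => sq_nonneg _)]
  have hsq (y : ℝ) : ENNReal.ofReal (y ^ 2) = ‖y‖ₑ ^ 2 := by
    rw [Real.enorm_eq_ofReal_abs, ← ENNReal.ofReal_pow (abs_nonneg _), sq_abs]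
  simp only [hsq]
  have hschur := lintegral_sq_lintegral_kernel_le (μ := radialMeasure) (ν := radialMeasure)
    (K := fun x ρ => ENNReal.ofReal (abelKernel ρ x)) (A := 2) (B := 2)
    (measurable_abelKernel.comp measurable_swap).ennreal_ofReal
    (ae_radialMeasure_mem.mono fun x hx => lintegral_abelKernel_left_le hx)
    (ae_radialMeasure_mem.mono fun ρ hρ => lintegral_abelKernel_right_le hρ) hdz.enorm
  calc ∫⁻ x, ‖kernelAbelAdjoint d (x, z)‖ₑ ^ 2 ∂radialMeasure
      ≤ ∫⁻ x, (∫⁻ ρ, ENNReal.ofReal (abelKernel ρ x) * ‖d (ρ, z)‖ₑ ∂radialMeasure) ^ 2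
          ∂radialMeasure := by
        refine lintegral_mono fun x => pow_le_pow_left' ?_ 2
        refine (enorm_integral_le_lintegral_enorm _).trans_eq (lintegral_congr fun ρ => ?_)
        rw [enorm_mul, Real.enorm_of_nonneg (abelKernel_nonneg _ _)]
    _ ≤ _ := hschur
    _ = _ := by norm_num

/-- The Cauchy–Schwarz inequality with respect to `cylMeasure`. -/
theorem integral_mul_le_sqrt_mul_sqrt {F G : ℝ × ℝ → ℝ} (hF : MemLp F 2 cylMeasure)
    (hG : MemLp G 2 cylMeasure) :
    ∫ p, F p * G p ∂cylMeasure ≤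
      Real.sqrt (∫ p, F p ^ 2 ∂cylMeasure) * Real.sqrt (∫ p, G p ^ 2 ∂cylMeasure) := by
  have h := integral_mul_norm_le_Lp_mul_Lq Real.HolderConjugate.two_two
    (by simpa using hF) (by simpa using hG)
  have habs : ∀ y : ℝ, ‖y‖ ^ (2 : ℝ) = y ^ 2 := fun y => by
    rw [Real.rpow_ofNat, Real.norm_eq_abs, sq_abs]
  simp only [habs] at h
  rw [Real.sqrt_eq_rpow, Real.sqrt_eq_rpow]
  refine le_trans ?_ h
  simp only [← norm_mul]
  exact (Real.le_norm_self _).trans (norm_integral_le_integral_norm fun p => F p * G p)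

theorem memLp_two_cylMeasure_of_bound {F : ℝ × ℝ → ℝ} (hF : Measurable F) {B : ℝ}
    (hB : ∀ p : ℝ × ℝ, p.1 ∈ Ioo (0 : ℝ) 1 → |F p| ≤ B) : MemLp F 2 cylMeasure :=
  MemLp.of_bound hF.aestronglyMeasurable B (ae_cylMeasure_fst_mem.mono fun p hp => hB p hp)

/-- The smoothed test function `η` is, up to the factor `1 / (π h)`, the second adjoint Abel
transform of `ψ - η`; hence it pairs with `v` through the Abel transform of `v`. -/
theorem integral_mul_radialSmoothing_le {v ψ : ℝ × ℝ → ℝ} {A M h : ℝ} (hh : 0 < h) (hA : 0 ≤ A)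
    (hM : 0 ≤ M) (hv : Measurable v) (hvA : ∀ p, |v p| ≤ A) (hψ : ContDiff ℝ 1 ψ)
    (hψM : ∀ p, |ψ p| ≤ M) :
    ∫ p, v p * radialSmoothing h ψ p ∂cylMeasure ≤
      2 / (Real.pi * h) * (Real.sqrt (∫ p, kernelAbel v p ^ 2 ∂cylMeasure) *
        Real.sqrt (∫ p, ψ p ^ 2 ∂cylMeasure)) := by
  have hηm := (contDiff_radialSmoothing h hψ).continuous.measurable
  have hψm := hψ.continuous.measurable
  set d : ℝ × ℝ → ℝ := fun p => ψ p - radialSmoothing h ψ p with hd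
  have hdm : Measurable d := hψm.sub hηm
  have hηM : ∀ p : ℝ × ℝ, p.1 ∈ Ioo (0 : ℝ) 1 → |radialSmoothing h ψ p| ≤ M := fun p hp =>
    abs_radialSmoothing_le hh hψM hp.1.le p.2
  have hdM : ∀ p : ℝ × ℝ, p.1 ∈ Ioo (0 : ℝ) 1 → |d p| ≤ 2 * M := fun p hp => by
    calc |d p| ≤ |ψ p| + |radialSmoothing h ψ p| := abs_sub _ _
      _ ≤ 2 * M := by linarith [hψM p, hηM p hp]
  have hM2 : 0 ≤ 2 * M := by positivity
  have hf := measurable_kernelAbel hv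
  have hZ := measurable_kernelAbelAdjoint hdm
  have hfB := fun (p : ℝ × ℝ) (hp : p.1 ∈ Ioo (0 : ℝ) 1) =>
    norm_kernelAbel_le hA (fun q _ => hvA q) hp
  have hZB := fun (p : ℝ × ℝ) (hp : p.1 ∈ Ioo (0 : ℝ) 1) =>
    norm_kernelAbelAdjoint_le hM2 hdM hp
  have hslice (z : ℝ) : ∫ r, v (r, z) * radialSmoothing h ψ (r, z) ∂radialMeasure =
      1 / (Real.pi * h) *
        ∫ x, kernelAbel v (x, z) * kernelAbelAdjoint d (x, z) ∂radialMeasure := by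
    have h1 := integral_abel_mul_adjoint (g := fun r => v (r, z)) (d := fun r => d (r, z))
      (hv.comp measurable_prodMk_right) (hdm.comp measurable_prodMk_right)
      (fun r _ => hvA (r, z)) (fun r hr => hdM (r, z) hr)
    simp only [kernelAbel, kernelAbelAdjoint]
    rw [h1]
    have h2 : ∫ r, v (r, z) * (∫ ρ, (if ρ < r then d (ρ, z) else 0) ∂radialMeasure)
        ∂radialMeasure = ∫ r, h * (v (r, z) * radialSmoothing h ψ (r, z)) ∂radialMeasure := by
      refine integral_congr_ae ?_
      filter_upwards [ae_radialMeasure_mem] with r hr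
      rw [hd, integral_sub_radialSmoothing hh hψ hr z]; ring
    rw [h2, integral_const_mul]
    have := Real.pi_ne_zero
    field_simp
  have hbound {F G : ℝ × ℝ → ℝ} {B C : ℝ} (hB : ∀ p : ℝ × ℝ, p.1 ∈ Ioo (0 : ℝ) 1 → |F p| ≤ B)
      (hC : ∀ p : ℝ × ℝ, p.1 ∈ Ioo (0 : ℝ) 1 → |G p| ≤ C) (p : ℝ × ℝ)
      (hp : p.1 ∈ Ioo (0 : ℝ) 1) : |F p * G p| ≤ B * C := by
    rw [abs_mul]
    exact mul_le_mul (hB p hp) (hC p hp) (abs_nonneg _) ((abs_nonneg _).trans (hB p hp))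
  have hsq {F : ℝ × ℝ → ℝ} (hF : Measurable F) {B : ℝ}
      (hB : ∀ p : ℝ × ℝ, p.1 ∈ Ioo (0 : ℝ) 1 → |F p| ≤ B) :
      Integrable (fun p => F p ^ 2) cylMeasure := by
    simp only [pow_two]
    exact integrable_cylMeasure_of_bound (hF.mul hF) (hbound hB hB)
  have hψint := hsq hψm (fun p _ => hψM p)
  have hZint := hsq hZ hZB
  have hZle : ∫ p, kernelAbelAdjoint d p ^ 2 ∂cylMeasure ≤ 2 ^ 2 * ∫ p, ψ p ^ 2 ∂cylMeasure := by
    rw [integral_cylMeasure_symm hZint, integral_cylMeasure_symm hψint, ← integral_const_mul]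
    refine integral_mono hZint.integral_prod_right (hψint.integral_prod_right.const_mul _)
      fun z => ?_
    refine (integral_sq_kernelAbelAdjoint_le hdm hM2 hdM z).trans ?_
    norm_num
    exact integral_sq_sub_radialSmoothing_le hh hψ z
  calc ∫ p, v p * radialSmoothing h ψ p ∂cylMeasure
      = 1 / (Real.pi * h) * ∫ p, kernelAbel v p * kernelAbelAdjoint d p ∂cylMeasure := by
        have h1 : Integrable (fun p => v p * radialSmoothing h ψ p) cylMeasure :=
          integrable_cylMeasure_of_bound (hv.mul hηm) (hbound (fun p _ => hvA p) hηM)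
        have h2 : Integrable (fun p => kernelAbel v p * kernelAbelAdjoint d p) cylMeasure :=
          integrable_cylMeasure_of_bound (hf.mul hZ) (hbound hfB hZB)
        rw [integral_cylMeasure_symm h1, integral_cylMeasure_symm h2, ← integral_const_mul]
        exact integral_congr_ae (ae_of_all _ hslice)
    _ ≤ 1 / (Real.pi * h) * (Real.sqrt (∫ p, kernelAbel v p ^ 2 ∂cylMeasure) *
          Real.sqrt (∫ p, kernelAbelAdjoint d p ^ 2 ∂cylMeasure)) := by
        gcongr
        exact integral_mul_le_sqrt_mul_sqrt (memLp_two_cylMeasure_of_bound hf hfB)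
          (memLp_two_cylMeasure_of_bound hZ hZB)
    _ ≤ 1 / (Real.pi * h) * (Real.sqrt (∫ p, kernelAbel v p ^ 2 ∂cylMeasure) *
          (2 * Real.sqrt (∫ p, ψ p ^ 2 ∂cylMeasure))) := by
        gcongr
        refine (Real.sqrt_le_sqrt hZle).trans_eq ?_
        rw [Real.sqrt_mul (by norm_num), Real.sqrt_sq (by norm_num)]
    _ = _ := by ring

/-! ### Mollification and the interpolation inequality -/

theorem cylMeasure_absolutelyContinuous : cylMeasure ≪ volume.restrict (interior Omega) := by
  rw [cylMeasure_eq_withDensity]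
  exact withDensity_absolutelyContinuous _ _

/-- A bounded function vanishing off a compact rectangle inside `(0, ∞) × (-1, 1)` is an a.e. limit
of `C¹` functions with the same bound, vanishing off a slightly larger rectangle. -/
theorem exists_mollification {w : ℝ × ℝ → ℝ} {M a b c d : ℝ} (hw : Measurable w)
    (hwM : ∀ p, |w p| ≤ M) (ha : 0 < a) (hc : -1 < c) (hd : d < 1)
    (hw0 : ∀ p ∉ Icc a b ×ˢ Icc c d, w p = 0) :
    ∃ ψ : ℕ → ℝ × ℝ → ℝ, (∀ n, ContDiff ℝ 1 (ψ n)) ∧ (∀ n p, |ψ n p| ≤ M) ∧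
      (∀ n, ∀ p ∉ Icc (a / 2) (b + a / 2) ×ˢ Icc ((c - 1) / 2) ((d + 1) / 2), ψ n p = 0) ∧
      ∀ᵐ p, Filter.Tendsto (fun n => ψ n p) Filter.atTop (𝓝 (w p)) := by
  set ε := min (a / 2) (min ((c + 1) / 2) ((1 - d) / 2)) with hε
  have hε0 : 0 < ε := by
    refine lt_min (by linarith) (lt_min (by linarith) (by linarith))
  have hε1 : ε ≤ a / 2 := min_le_left _ _
  have hε2 : ε ≤ (c + 1) / 2 := (min_le_right _ _).trans (min_le_left _ _)
  have hε3 : ε ≤ (1 - d) / 2 := (min_le_right _ _).trans (min_le_right _ _)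
  let φ : ℕ → ContDiffBump (0 : ℝ × ℝ) := fun n =>
    ⟨ε / (n + 1) / 2, ε / (n + 1), by positivity, half_lt_self (by positivity)⟩
  have hrε (n : ℕ) : (φ n).rOut ≤ ε := div_le_self hε0.le (by linarith [n.cast_nonneg (α := ℝ)])
  have hloc : LocallyIntegrable w := by
    intro x
    exact ⟨Metric.ball x 1, Metric.ball_mem_nhds x one_pos,
      Measure.integrableOn_of_bounded (M := M) measure_ball_lt_top.ne hw.aestronglyMeasurable
        (ae_of_all _ hwM)⟩
  refine ⟨fun n => MeasureTheory.convolution ((φ n).normed volume) w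
    (ContinuousLinearMap.lsmul ℝ ℝ) volume, fun n => ?_, fun n p => ?_, fun n p hp => ?_, ?_⟩
  · exact (φ n).hasCompactSupport_normed.contDiff_convolution_left _ (φ n).contDiff_normed hloc
  · simp only [MeasureTheory.convolution, ← Real.norm_eq_abs]
    refine (norm_integral_le_of_norm_le (g := fun t => (φ n).normed volume t * M)
      ((φ n).integrable_normed.mul_const M) (ae_of_all _ fun t => ?_)).trans_eq ?_
    · rw [ContinuousLinearMap.lsmul_apply, norm_smul, Real.norm_of_nonneg ((φ n).nonneg_normed t)]
      exact mul_le_mul_of_nonneg_left (hwM _) ((φ n).nonneg_normed t)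
    · rw [integral_mul_const, (φ n).integral_normed, one_mul]
  · simp only [MeasureTheory.convolution]
    rw [integral_eq_zero_of_ae]
    refine ae_of_all _ fun t => ?_
    simp only [ContinuousLinearMap.lsmul_apply, Pi.zero_apply, smul_eq_mul, mul_eq_zero]
    by_contra hcon
    push Not at hcon
    have ht : t ∈ Metric.ball (0 : ℝ × ℝ) (φ n).rOut := by
      rw [← (φ n).support_normed_eq (μ := volume)]; exact hcon.1
    have htε : ‖t‖ < ε := (mem_ball_zero_iff.1 ht).trans_le (hrε n)
    have h1 := abs_lt.1 ((norm_fst_le t).trans_lt htε)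
    have h2 := abs_lt.1 ((norm_snd_le t).trans_lt htε)
    have hmem : p - t ∈ Icc a b ×ˢ Icc c d := by
      by_contra hnot
      exact hcon.2 (hw0 _ hnot)
    obtain ⟨⟨k1, k2⟩, ⟨k3, k4⟩⟩ := hmem
    simp only [Prod.fst_sub, Prod.snd_sub] at k1 k2 k3 k4
    exact hp ⟨⟨by linarith, by linarith⟩, ⟨by linarith, by linarith⟩⟩
  · refine ContDiffBump.ae_convolution_tendsto_right_of_locallyIntegrable (K := 2) ?_ ?_ hloc
    · exact tendsto_const_div_atTop_nhds_zero_nat ε |>.comp (Filter.tendsto_add_atTop_nat 1)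
        |>.congr fun n => by simp [φ]
    · refine Filter.Eventually.of_forall fun n => ?_
      simp only [φ]; linarith

/-- Optimization over the smoothing scale `t`; the terms balance at `t = 2 * B / y`. -/
theorem pow_three_le_of_forall_le {y A B : ℝ} (hy : 0 ≤ y) (hA : 0 ≤ A) (hB : 0 ≤ B)
    (h : ∀ t : ℝ, 0 < t → y ^ 2 ≤ t * A + B / t * y) : y ^ 3 ≤ 4 * A * B := by
  rcases hy.eq_or_lt with rfl | hy
  · rw [zero_pow three_ne_zero]; positivity
  rcases hB.eq_or_lt with rfl | hB
  -- for `B = 0`, letting `t` tend to `0` would force `y = 0`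
  · exfalso
    have h1 := h (y ^ 2 / (2 * (A + 1))) (by positivity)
    have h2 : y ^ 2 / (2 * (A + 1)) * A ≤ y ^ 2 / 2 := by
      rw [div_mul_eq_mul_div, div_le_div_iff₀ (by positivity) (by positivity)]
      nlinarith [sq_nonneg y]
    have : 0 < y ^ 2 := by positivity
    simp only [zero_div, zero_mul, add_zero] at h1
    linarith
  · have h1 := h (2 * B / y) (by positivity)
    have h2 : B / (2 * B / y) * y = y ^ 2 / 2 := by field_simp
    have h3 : 2 * B / y * A * y = 2 * B * A := by field_simp
    rw [h2] at h1
    nlinarith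

/-- The interpolation inequality with a test function: smoothing `ψ` at scale `h` splits the
pairing with `v` into a total-variation part and an Abel-transform part. -/
theorem integral_mul_test_le {v ψ : ℝ × ℝ → ℝ} {h M β a b c d : ℝ} (hh : 0 < h) (hM : 0 < M)
    (hβ : β < 1) (hvm : Measurable v) (hvM : ∀ p, |v p| ≤ M)
    (hv : ∀ p : ℝ × ℝ, β ≤ p.1 → v p = 0)
    (hTV : totalVariation v (interior Omega) ≠ ∞) (hψ : ContDiff ℝ 1 ψ)
    (hψM : ∀ p, |ψ p| ≤ M) (ha : 0 < a) (hc : -1 < c) (hd : d < 1)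
    (hψ0 : ∀ p ∉ Icc a b ×ˢ Icc c d, ψ p = 0) :
    ∫ p, v p * ψ p ∂cylMeasure ≤
      h * (M * (totalVariation v (interior Omega)).toReal) +
        2 / Real.pi * Real.sqrt (∫ p, kernelAbel v p ^ 2 ∂cylMeasure) / h *
          Real.sqrt (∫ p, ψ p ^ 2 ∂cylMeasure) := by
  have h1 := integral_mul_sub_radialSmoothing_le hh hM hβ hv hTV hψ hψM ha hc hd hψ0
  have h2 := integral_mul_radialSmoothing_le hh hM.le hM.le hvm hvM hψ hψM
  have hηm := (contDiff_radialSmoothing h hψ).continuous.measurable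
  have hψm := hψ.continuous.measurable
  have hηM : ∀ p : ℝ × ℝ, p.1 ∈ Ioo (0 : ℝ) 1 → |radialSmoothing h ψ p| ≤ M := fun p hp =>
    abs_radialSmoothing_le hh hψM hp.1.le p.2
  have hi1 : Integrable (fun p => v p * ψ p) cylMeasure :=
    integrable_cylMeasure_of_bound (hvm.mul hψm) (B := M * M) fun p _ => by
      rw [abs_mul]; exact mul_le_mul (hvM p) (hψM p) (abs_nonneg _) hM.le
  have hi2 : Integrable (fun p => v p * radialSmoothing h ψ p) cylMeasure :=
    integrable_cylMeasure_of_bound (hvm.mul hηm) (B := M * M) fun p hp => by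
      rw [abs_mul]; exact mul_le_mul (hvM p) (hηM p hp) (abs_nonneg _) hM.le
  have hsplit : ∫ p, v p * (ψ p - radialSmoothing h ψ p) ∂cylMeasure =
      ∫ p, v p * ψ p ∂cylMeasure - ∫ p, v p * radialSmoothing h ψ p ∂cylMeasure := by
    rw [← integral_sub hi1 hi2]
    simp only [mul_sub]
  have h3 : 2 / Real.pi * Real.sqrt (∫ p, kernelAbel v p ^ 2 ∂cylMeasure) / h *
          Real.sqrt (∫ p, ψ p ^ 2 ∂cylMeasure) =
      2 / (Real.pi * h) * (Real.sqrt (∫ p, kernelAbel v p ^ 2 ∂cylMeasure) *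
        Real.sqrt (∫ p, ψ p ^ 2 ∂cylMeasure)) := by
    have := Real.pi_ne_zero
    field_simp
  rw [h3]
  linarith

/-- The interpolation inequality for the restriction of `v` to a compact rectangle. -/
theorem sqrt_integral_sq_indicator_pow_three_le {v : ℝ × ℝ → ℝ} {M β a b c d : ℝ} (hM : 0 < M)
    (hβ : β < 1) (hvm : Measurable v) (hvM : ∀ p, |v p| ≤ M)
    (hv : ∀ p : ℝ × ℝ, β ≤ p.1 → v p = 0)
    (hTV : totalVariation v (interior Omega) ≠ ∞) (ha : 0 < a) (hc : -1 < c) (hd : d < 1) :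
    Real.sqrt (∫ p, (Icc a b ×ˢ Icc c d).indicator v p ^ 2 ∂cylMeasure) ^ 3 ≤
      4 * (M * (totalVariation v (interior Omega)).toReal) *
        (2 / Real.pi * Real.sqrt (∫ p, kernelAbel v p ^ 2 ∂cylMeasure)) := by
  set K := Icc a b ×ˢ Icc c d with hK
  have hKm : MeasurableSet K := measurableSet_Icc.prod measurableSet_Icc
  set w := K.indicator v with hw
  have hwm : Measurable w := hvm.indicator hKm
  have hwM : ∀ p, |w p| ≤ M := fun p => by
    by_cases hp : p ∈ K
    · rw [hw, indicator_of_mem hp]; exact hvM p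
    · rw [hw, indicator_of_notMem hp]; simpa using hM.le
  obtain ⟨ψ, hψd, hψM, hψ0, hψlim⟩ := exists_mollification hwm hwM ha hc hd
    (fun p hp => indicator_of_notMem hp v)
  have hlim : ∀ᵐ p ∂cylMeasure, Filter.Tendsto (fun n => ψ n p) Filter.atTop (𝓝 (w p)) :=
    (cylMeasure_absolutelyContinuous.trans Measure.restrict_le_self.absolutelyContinuous).ae_le
      hψlim
  have hvw : ∀ p, v p * w p = w p ^ 2 := fun p => by
    by_cases hp : p ∈ K
    · rw [hw, indicator_of_mem hp]; ring
    · rw [hw, indicator_of_notMem hp]; ring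
  have hlim1 : Filter.Tendsto (fun n => ∫ p, v p * ψ n p ∂cylMeasure) Filter.atTop
      (𝓝 (∫ p, w p ^ 2 ∂cylMeasure)) := by
    simp only [← hvw]
    refine tendsto_integral_of_dominated_convergence (fun _ => M * M)
      (fun n => (hvm.mul (hψd n).continuous.measurable).aestronglyMeasurable)
      (integrable_const _) (fun n => ae_of_all _ fun p => ?_) ?_
    · rw [norm_mul]; exact mul_le_mul (hvM p) (hψM n p) (abs_nonneg _) hM.le
    · filter_upwards [hlim] with p hp
      exact hp.const_mul _
  have hlim2 : Filter.Tendsto (fun n => ∫ p, ψ n p ^ 2 ∂cylMeasure) Filter.atTop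
      (𝓝 (∫ p, w p ^ 2 ∂cylMeasure)) := by
    refine tendsto_integral_of_dominated_convergence (fun _ => M ^ 2)
      (fun n => ((hψd n).continuous.measurable.pow_const 2).aestronglyMeasurable)
      (integrable_const _) (fun n => ae_of_all _ fun p => ?_) ?_
    · rw [norm_pow]; exact pow_le_pow_left₀ (abs_nonneg _) (hψM n p) 2
    · filter_upwards [hlim] with p hp
      exact hp.pow 2
  have := Real.pi_pos
  refine pow_three_le_of_forall_le (Real.sqrt_nonneg _) (by positivity) (by positivity)
    fun t ht => ?_
  rw [Real.sq_sqrt (integral_nonneg fun _ => sq_nonneg _)]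
  refine le_of_tendsto_of_tendsto' hlim1 (((Real.continuous_sqrt.tendsto _).comp
    hlim2).const_mul _ |>.const_add _) fun n => ?_
  exact integral_mul_test_le ht hM hβ hvm hvM hv hTV (hψd n) (hψM n) (half_pos ha) (by linarith)
    (by linarith) (hψ0 n)

/-- The interpolation inequality between `L^∞ ∩ BV` and the `L²` norm of the Abel transform. -/
theorem sqrt_integral_sq_pow_three_le {v : ℝ × ℝ → ℝ} {M β : ℝ} (hM : 0 ≤ M)
    (hβ : β < 1) (hvm : Measurable v) (hvM : ∀ p, |v p| ≤ M)
    (hv : ∀ p : ℝ × ℝ, β ≤ p.1 → v p = 0)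
    (hTV : totalVariation v (interior Omega) ≠ ∞) :
    Real.sqrt (∫ p, v p ^ 2 ∂cylMeasure) ^ 3 ≤
      4 * (M * (totalVariation v (interior Omega)).toReal) *
        (2 / Real.pi * Real.sqrt (∫ p, kernelAbel v p ^ 2 ∂cylMeasure)) := by
  rcases hM.eq_or_lt with rfl | hM
  · have : ∀ p, v p = 0 := fun p => abs_nonpos_iff.1 (hvM p)
    simp [this]
  let δ : ℕ → ℝ := fun n => 1 / ((n : ℝ) + 1)
  have hδ0 : Filter.Tendsto δ Filter.atTop (𝓝 0) := tendsto_one_div_add_atTop_nhds_zero_nat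
  have hδpos (n : ℕ) : 0 < δ n := by positivity
  let K : ℕ → Set (ℝ × ℝ) := fun n => Icc (δ n) 1 ×ˢ Icc (-1 + δ n) (1 - δ n)
  have hlim : Filter.Tendsto (fun n => ∫ p, (K n).indicator v p ^ 2 ∂cylMeasure) Filter.atTop
      (𝓝 (∫ p, v p ^ 2 ∂cylMeasure)) := by
    refine tendsto_integral_of_dominated_convergence (fun _ => M ^ 2)
      (fun n => ((hvm.indicator (measurableSet_Icc.prod measurableSet_Icc)).pow_const
        2).aestronglyMeasurable)
      (integrable_const _) (fun n => ae_of_all _ fun p => ?_) ?_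
    · rw [norm_pow]
      exact pow_le_pow_left₀ (norm_nonneg _)
        ((norm_indicator_le_norm_self v p).trans (hvM p)) 2
    · filter_upwards [cylMeasure_absolutelyContinuous.ae_le
        (ae_restrict_mem isOpen_interior.measurableSet)] with p hp
      rw [interior_Omega] at hp
      refine tendsto_const_nhds.congr' ?_
      filter_upwards [hδ0.eventually_lt_const hp.1.1,
        hδ0.eventually_lt_const (show (0 : ℝ) < p.2 + 1 by linarith [hp.2.1]),
        hδ0.eventually_lt_const (show (0 : ℝ) < 1 - p.2 by linarith [hp.2.2])] with n h1 h2 h3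
      rw [indicator_of_mem]
      exact ⟨⟨h1.le, hp.1.2.le⟩, ⟨by linarith, by linarith⟩⟩
  refine le_of_tendsto' (((Real.continuous_sqrt.tendsto _).comp hlim).pow 3) fun n => ?_
  exact sqrt_integral_sq_indicator_pow_three_le hM hβ hvm hvM hv hTV (hδpos n)
    (by linarith [hδpos n]) (by linarith [hδpos n])

/-! ### Cylindrical coordinates -/

/-- The cylindrical coordinates `(r, z)` of a point of `ℝ³`. -/
def toCyl (p : (ℝ × ℝ) × ℝ) : ℝ × ℝ := (Real.sqrt (p.1.1 ^ 2 + p.1.2 ^ 2), p.2)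

theorem measurable_toCyl : Measurable toCyl := by
  unfold toCyl; fun_prop

theorem measurableSet_disc : MeasurableSet {q : ℝ × ℝ | q.1 ^ 2 + q.2 ^ 2 ≤ 1} :=
  measurableSet_le (by fun_prop) measurable_const

theorem measurableSet_cylinder : MeasurableSet cylinder :=
  measurableSet_disc.prod measurableSet_Icc

theorem lintegral_disc {G : ℝ → ℝ≥0∞} (hG : Measurable G) :
    ∫⁻ q in {q : ℝ × ℝ | q.1 ^ 2 + q.2 ^ 2 ≤ 1}, G (Real.sqrt (q.1 ^ 2 + q.2 ^ 2)) =
      ENNReal.ofReal Real.pi * ∫⁻ r, G r ∂radialMeasure := by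
  have hpolar (p : ℝ × ℝ) : (polarCoord.symm p).1 ^ 2 + (polarCoord.symm p).2 ^ 2 = p.1 ^ 2 := by
    simp only [polarCoord_symm_apply]
    nlinarith [Real.sin_sq_add_cos_sq p.2]
  rw [← lintegral_indicator measurableSet_disc, ← lintegral_comp_polarCoord_symm,
    polarCoord_target, Measure.volume_eq_prod, ← Measure.prod_restrict]
  have hGm : Measurable fun r : ℝ => ENNReal.ofReal r * (Iic (1 : ℝ)).indicator G r := by
    have := hG.indicator (measurableSet_Iic (a := (1 : ℝ)))
    fun_prop
  calc _ = ∫⁻ p, (ENNReal.ofReal p.1 * (Iic (1 : ℝ)).indicator G p.1)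
            ∂((volume.restrict (Ioi (0 : ℝ))).prod (volume.restrict (Ioo (-Real.pi) Real.pi))) := by
        refine lintegral_congr_ae ?_
        have h0 : ∀ᵐ p ∂((volume.restrict (Ioi (0 : ℝ))).prod
            (volume.restrict (Ioo (-Real.pi) Real.pi))), p.1 ∈ Ioi (0 : ℝ) :=
          Measure.quasiMeasurePreserving_fst.ae (ae_restrict_mem measurableSet_Ioi)
        filter_upwards [h0] with p hp
        rw [smul_eq_mul]
        have hp0 : 0 ≤ p.1 := (mem_Ioi.1 hp).le
        congr 1
        simp only [indicator, mem_ofPred_eq, hpolar, mem_Iic, Real.sqrt_sq hp0,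
          sq_le_one_iff₀ hp0]
    _ = (∫⁻ r in Ioi 0, ENNReal.ofReal r * (Iic (1 : ℝ)).indicator G r) *
          ENNReal.ofReal (2 * Real.pi) := by
        have hm : Measurable fun p : ℝ × ℝ =>
          ENNReal.ofReal p.1 * (Iic (1 : ℝ)).indicator G p.1 := hGm.comp measurable_fst
        rw [lintegral_prod _ hm.aemeasurable]
        simp only [lintegral_const, Measure.restrict_apply_univ, Real.volume_Ioo]
        rw [lintegral_mul_const _ hGm]
        congr 2; ring
    _ = (∫⁻ r in Ioo 0 1, ENNReal.ofReal r * G r) * ENNReal.ofReal (2 * Real.pi) := by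
        congr 1
        have : ∀ r, ENNReal.ofReal r * (Iic (1 : ℝ)).indicator G r =
            (Iic (1 : ℝ)).indicator (fun r => ENNReal.ofReal r * G r) r := fun r => by
          by_cases hr : r ∈ Iic (1 : ℝ) <;> simp [hr]
        simp only [this]
        rw [lintegral_indicator measurableSet_Iic, Measure.restrict_restrict measurableSet_Iic,
          inter_comm, Ioi_inter_Iic, restrict_Ioo_eq_restrict_Ioc]
    _ = _ := by
        rw [lintegral_radialMeasure hG, mul_comm, ENNReal.ofReal_mul zero_le_two,
          mul_comm (ENNReal.ofReal 2), mul_assoc, ← lintegral_const_mul _ (by fun_prop)]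
        congr 2
        ext r
        rw [ENNReal.ofReal_mul zero_le_two, mul_assoc]

/-- Integration in cylindrical coordinates; the angle contributes `2π`, and
`2π r dr dz = π d(cylMeasure)`. -/
theorem lintegral_cylinder {F : ℝ × ℝ → ℝ≥0∞} (hF : Measurable F) :
    ∫⁻ p in cylinder, F (toCyl p) = ENNReal.ofReal Real.pi * ∫⁻ p, F p ∂cylMeasure := by
  have hFc : Measurable fun p => F (toCyl p) := hF.comp measurable_toCyl
  rw [cylinder, Measure.volume_eq_prod, ← Measure.prod_restrict,
    lintegral_prod_symm _ hFc.aemeasurable, cylMeasure,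
    lintegral_prod_symm _ hF.aemeasurable, restrict_Ioo_eq_restrict_Icc]
  have hm : Measurable fun z => ∫⁻ r, F (r, z) ∂radialMeasure :=
    Measurable.lintegral_prod_left (f := fun r z => F (r, z)) hF
  rw [← lintegral_const_mul _ hm]
  exact lintegral_congr fun z => lintegral_disc (G := fun r => F (r, z))
    (hF.comp measurable_prodMk_right)

theorem quasiMeasurePreserving_toCyl :
    Measure.QuasiMeasurePreserving toCyl (volume.restrict cylinder) cylMeasure := by
  refine ⟨measurable_toCyl, Measure.AbsolutelyContinuous.mk fun s hs h0 => ?_⟩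
  rw [Measure.map_apply measurable_toCyl hs, ← lintegral_indicator_one
    (measurable_toCyl hs)]
  have := lintegral_cylinder (F := s.indicator 1) (measurable_one.indicator hs)
  rw [lintegral_indicator_one hs, h0, mul_zero] at this
  exact this

/-- An axisymmetric function is determined by its profile. -/
theorem IsAxisymmetricOn.eq_profile {u : (ℝ × ℝ) × ℝ → ℝ} (hu : IsAxisymmetricOn u cylinder)
    {p : (ℝ × ℝ) × ℝ} (hp : p ∈ cylinder) : u p = profile u (toCyl p) := by
  obtain ⟨⟨x, y⟩, z⟩ := p
  have hsq : Real.sqrt (x ^ 2 + y ^ 2) ^ 2 = x ^ 2 + y ^ 2 := Real.sq_sqrt (by positivity)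
  have hmem : (((Real.sqrt (x ^ 2 + y ^ 2), 0), z) : (ℝ × ℝ) × ℝ) ∈ cylinder := by
    refine ⟨?_, hp.2⟩
    have := hp.1
    simp only [mem_ofPred_eq] at this ⊢
    rw [hsq]; simpa using this
  have hnorm : ‖(⟨x, y⟩ : ℂ)‖ = Real.sqrt (x ^ 2 + y ^ 2) := by
    rw [Complex.norm_def, Complex.normSq_mk]; congr 1; ring
  have h := hu _ hmem (Complex.arg ⟨x, y⟩)
  have hre := Complex.norm_mul_cos_arg (⟨x, y⟩ : ℂ)
  have him := Complex.norm_mul_sin_arg (⟨x, y⟩ : ℂ)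
  rw [hnorm, mul_comm] at hre him
  simp only [rotZ, mul_zero, sub_zero, add_zero, hre, him] at h
  exact h

/-! ### Bounded Borel representatives -/

theorem restrict_interior_Omega :
    (volume : Measure (ℝ × ℝ)).restrict (interior Omega) = volume.restrict Omega := by
  rw [interior_Omega, Omega, Measure.volume_eq_prod, ← Measure.prod_restrict,
    ← Measure.prod_restrict, restrict_Ioo_eq_restrict_Icc, restrict_Ioo_eq_restrict_Icc]

theorem measurableSet_Omega : MeasurableSet Omega := measurableSet_Icc.prod measurableSet_Icc

/-- A function whose essential support avoids the edge `r = 1` vanishes a.e. near that edge. -/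
theorem exists_ae_eq_zero_of_essSupport_subset {w : ℝ × ℝ → ℝ}
    (hw : essSupport w Omega ⊆ Ico 0 1 ×ˢ Icc (-1) 1) :
    ∃ β < 1, ∀ᵐ p ∂(volume.restrict Omega), β ≤ p.1 → w p = 0 := by
  set n : Set (ℝ × ℝ) := (essSupport w Omega)ᶜ with hn
  have hnmem : ∀ p ∈ n, ∃ V ∈ 𝓝 p, volume.restrict Omega (V ∩ {q | w q ≠ 0}) = 0 := by
    intro p hp
    simpa [hn, essSupport] using hp
  have hopen : IsOpen n := by
    rw [isOpen_iff_mem_nhds]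
    intro p hp
    obtain ⟨V, hV, h0⟩ := hnmem p hp
    filter_upwards [eventually_mem_nhds_iff.2 hV] with q hq hmem
    exact hmem V hq h0
  have hnull : volume.restrict Omega (n ∩ {q | w q ≠ 0}) = 0 := by
    refine measure_null_of_locally_null _ fun p hp => ?_
    obtain ⟨V, hV, h0⟩ := hnmem p hp.1
    exact ⟨V ∩ {q | w q ≠ 0}, Filter.inter_mem (mem_nhdsWithin_of_mem_nhds hV)
      (Filter.mem_of_superset self_mem_nhdsWithin inter_subset_right), h0⟩
  have hedge : ({1} : Set ℝ) ×ˢ Icc (-1 : ℝ) 1 ⊆ n := by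
    rintro p ⟨hp1, -⟩ hp
    have := (hw hp).1.2
    rw [mem_singleton_iff.1 hp1] at this
    exact lt_irrefl _ this
  obtain ⟨U, V, hU, -, h1U, hV, hUV⟩ :=
    generalized_tube_lemma isCompact_singleton isCompact_Icc hopen hedge
  obtain ⟨ε, hε, hball⟩ := Metric.isOpen_iff.1 hU 1 (h1U rfl)
  refine ⟨1 - ε / 2, by linarith, ?_⟩
  have hae : ∀ᵐ p ∂(volume.restrict Omega), p ∉ n ∩ {q | w q ≠ 0} :=
    measure_eq_zero_iff_ae_notMem.1 hnull
  filter_upwards [hae, ae_restrict_mem measurableSet_Omega] with p hp hpO hβ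
  by_contra hne
  refine hp ⟨hUV ⟨hball ?_, hV hpO.2⟩, hne⟩
  rw [Metric.mem_ball, Real.dist_eq, abs_lt]
  constructor <;> linarith [hpO.1.2]

/-- A bounded function on `Omega` whose essential support avoids the edge `r = 1` has an everywhere
bounded Borel representative that vanishes near that edge and off the open rectangle. -/
theorem exists_bounded_representative {w : ℝ × ℝ → ℝ} (hw : MemLp w ∞ (volume.restrict Omega))
    (hsupp : essSupport w Omega ⊆ Ico 0 1 ×ˢ Icc (-1) 1) :
    ∃ (v : ℝ × ℝ → ℝ) (β : ℝ), Measurable v ∧ β < 1 ∧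
      (∀ p, |v p| ≤ (eLpNorm w ∞ (volume.restrict Omega)).toReal) ∧
      (∀ p : ℝ × ℝ, β ≤ p.1 → v p = 0) ∧ (∀ p ∉ interior Omega, v p = 0) ∧
      w =ᵐ[volume.restrict Omega] v := by
  obtain ⟨β, hβ, hβ0⟩ := exists_ae_eq_zero_of_essSupport_subset hsupp
  set M := (eLpNorm w ∞ (volume.restrict Omega)).toReal with hM
  have hM0 : 0 ≤ M := ENNReal.toReal_nonneg
  have hwM : ∀ᵐ p ∂(volume.restrict Omega), |w p| ≤ M := by
    have := ae_le_eLpNormEssSup (f := w) (μ := volume.restrict Omega)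
    filter_upwards [this] with p hp
    rw [← eLpNorm_exponent_top] at hp
    rw [← Real.norm_eq_abs, ← toReal_enorm]
    exact ENNReal.toReal_mono hw.2.ne hp
  set v₀ := hw.1.mk w
  have hv₀ : Measurable v₀ := hw.1.stronglyMeasurable_mk.measurable
  set S : Set (ℝ × ℝ) := (interior Omega ∩ {p | p.1 < β}) ∩ {p | |v₀ p| ≤ M} with hS
  have hSm : MeasurableSet S := (isOpen_interior.measurableSet.inter
    (measurableSet_lt measurable_fst measurable_const)).inter
    (measurableSet_le hv₀.abs measurable_const)
  refine ⟨S.indicator v₀, β, hv₀.indicator hSm, hβ, fun p => ?_, fun p hp => ?_, fun p hp => ?_, ?_⟩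
  · by_cases h : p ∈ S
    · rw [indicator_of_mem h]; exact h.2
    · rw [indicator_of_notMem h]; simpa using hM0
  · exact indicator_of_notMem (fun h => not_lt.2 hp h.1.2) _
  · exact indicator_of_notMem (fun h => hp h.1.1) _
  · have hint : ∀ᵐ p ∂(volume.restrict Omega), p ∈ interior Omega := by
      rw [← restrict_interior_Omega]
      exact ae_restrict_mem isOpen_interior.measurableSet
    filter_upwards [hint, hwM, hβ0, hw.1.ae_eq_mk] with p h1 h2 h3 h4
    by_cases h : p ∈ S
    · rw [indicator_of_mem h]; exact h4
    · rw [indicator_of_notMem h]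
      by_contra hne
      refine h ⟨⟨h1, ?_⟩, ?_⟩
      · by_contra hlt
        exact hne (h3 (not_lt.1 hlt))
      · change |hw.1.mk w p| ≤ M
        rw [← h4]; exact h2

/-- For a Borel function supported in the open rectangle, the improper integral defining the Abel
transform converges absolutely and equals `kernelAbel`. -/
theorem integrableOn_abel_and_integral_eq {v : ℝ × ℝ → ℝ} {M : ℝ} (hv : Measurable v)
    (hvM : ∀ p, |v p| ≤ M) (hv0 : ∀ p ∉ interior Omega, v p = 0) {p : ℝ × ℝ}
    (hp : p.1 ∈ Ioo (0 : ℝ) 1) :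
    IntegrableOn (fun r => v (r, p.2) * r / Real.sqrt (r ^ 2 - p.1 ^ 2)) (Ioi p.1) ∧
      2 * ∫ r in Ioi p.1, v (r, p.2) * r / Real.sqrt (r ^ 2 - p.1 ^ 2) = kernelAbel v p := by
  have hκ := (integrable_of_lintegral_ofReal_le (measurable_abelKernel_right p.1)
    (abelKernel_nonneg p.1) (lintegral_abelKernel_right_le hp)).1
  have hκv : Integrable (fun r => abelKernel p.1 r * v (r, p.2)) radialMeasure :=
    hκ.mul_bdd (c := M) (hv.comp measurable_prodMk_right).aestronglyMeasurable
      (ae_of_all _ fun r => hvM (r, p.2))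
  have hIoo : IntegrableOn (fun r => 2 * r * (abelKernel p.1 r * v (r, p.2))) (Ioo 0 1) := by
    rw [radialMeasure, integrable_withDensity_iff_integrable_smul' measurable_radialDensity
      (ae_of_all _ fun _ => ENNReal.ofReal_lt_top)] at hκv
    refine IntegrableOn.congr_fun hκv (fun r hr => ?_) measurableSet_Ioo
    have : 0 ≤ 2 * r := by linarith [hr.1]
    simp only [ENNReal.toReal_ofReal this, smul_eq_mul]
  have hind : (Ioi p.1).indicator (fun r => v (r, p.2) * r / Real.sqrt (r ^ 2 - p.1 ^ 2)) =
      (Ioo 0 1).indicator fun r => 1 / 2 * (2 * r * (abelKernel p.1 r * v (r, p.2))) := by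
    ext r
    by_cases h1 : r ∈ Ioo (0 : ℝ) 1
    · rw [indicator_of_mem h1]
      by_cases h2 : p.1 < r
      · rw [indicator_of_mem (mem_Ioi.2 h2), abelKernel, if_pos h2]; ring
      · rw [indicator_of_notMem (show r ∉ Ioi p.1 from h2), abelKernel, if_neg h2]; ring
    · rw [indicator_of_notMem h1]
      have : v (r, p.2) = 0 := hv0 _ fun h => by
        rw [interior_Omega] at h; exact h1 h.1
      simp [indicator, this]
  constructor
  · rw [← integrable_indicator_iff measurableSet_Ioi, hind,
      integrable_indicator_iff measurableSet_Ioo]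
    exact hIoo.const_mul _
  · rw [← integral_indicator measurableSet_Ioi, hind, integral_indicator measurableSet_Ioo,
      integral_const_mul, ← integral_radialMeasure, kernelAbel]
    ring

/-- The Abel integrand of `u` agrees for a.e. `p` with that of any representative of its profile
vanishing off the open rectangle. -/
theorem ae_abelIntegrand_eq {u : (ℝ × ℝ) × ℝ → ℝ} {v : ℝ × ℝ → ℝ}
    (hv0 : ∀ p ∉ interior Omega, v p = 0) (huv : profile u =ᵐ[volume.restrict Omega] v) :
    ∀ᵐ p ∂(volume.restrict Omega), abelIntegrand (cylinder.indicator u) p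
      =ᵐ[volume.restrict (Ioi p.1)] fun r => v (r, p.2) * r / Real.sqrt (r ^ 2 - p.1 ^ 2) := by
  have h1 : ∀ᵐ q : ℝ × ℝ, q ∈ Omega → profile u q = v q :=
    (ae_restrict_iff' measurableSet_Omega).1 huv
  have h2 : ∀ᵐ q : ℝ × ℝ, q.swap ∈ Omega → profile u q.swap = v q.swap :=
    Measure.measurePreserving_swap.quasiMeasurePreserving.ae (p := fun q => q ∈ Omega → profile u q = v q) h1
  have h3 : ∀ᵐ z : ℝ, ∀ᵐ r : ℝ, (r, z) ∈ Omega → profile u (r, z) = v (r, z) :=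
    Measure.ae_ae_of_ae_prod h2
  have h4 : ∀ᵐ p : ℝ × ℝ, ∀ᵐ r : ℝ, (r, p.2) ∈ Omega → profile u (r, p.2) = v (r, p.2) :=
    Measure.quasiMeasurePreserving_snd.ae h3
  filter_upwards [ae_restrict_of_ae h4, ae_restrict_mem measurableSet_Omega] with p hp hpO
  filter_upwards [ae_restrict_of_ae hp, ae_restrict_mem measurableSet_Ioi] with r hr hrp
  have hr0 : 0 < r := hpO.1.1.trans_lt hrp
  have hcyl : ((r, 0), p.2) ∈ cylinder ↔ (r, p.2) ∈ Omega := by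
    simp only [cylinder, Omega, mem_prod, mem_ofPred_eq, mem_Icc]
    have : r ^ 2 + 0 ^ 2 ≤ 1 ↔ r ≤ 1 := by
      rw [zero_pow two_ne_zero, add_zero, sq_le_one_iff₀ hr0.le]
    rw [this]
    simp [hr0.le]
  have key : profile (cylinder.indicator u) (r, p.2) = v (r, p.2) := by
    unfold profile
    by_cases h : (r, p.2) ∈ Omega
    · rw [indicator_of_mem (hcyl.2 h)]; exact hr h
    · rw [indicator_of_notMem (fun h' => h (hcyl.1 h')), hv0 _ fun h' => h (interior_subset h')]
  simp only [abelIntegrand, key]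

/-! ### The stability estimate -/

theorem eLpNorm_two_sq {α : Type*} [MeasurableSpace α] (μ : Measure α) (g : α → ℝ) :
    eLpNorm g 2 μ ^ 2 = ∫⁻ x, ‖g x‖ₑ ^ 2 ∂μ := by
  have := eLpNorm_nnreal_pow_eq_lintegral (f := g) (μ := μ) (p := 2) two_ne_zero
  simpa using this

theorem lintegral_enorm_sq_eq_ofReal {v : ℝ × ℝ → ℝ}
    (hv : Integrable (fun p => v p ^ 2) cylMeasure) :
    ∫⁻ p, ‖v p‖ₑ ^ 2 ∂cylMeasure = ENNReal.ofReal (∫ p, v p ^ 2 ∂cylMeasure) := by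
  rw [ofReal_integral_eq_lintegral_ofReal hv (ae_of_all _ fun _ => sq_nonneg _)]
  refine lintegral_congr fun p => ?_
  rw [Real.enorm_eq_ofReal_abs, ← ENNReal.ofReal_pow (abs_nonneg _), sq_abs]

theorem eLpNorm_comp_toCyl {v : ℝ × ℝ → ℝ} (hv : Measurable v)
    (hv2 : Integrable (fun p => v p ^ 2) cylMeasure) :
    eLpNorm (fun p => v (toCyl p)) 2 (volume.restrict cylinder) =
      ENNReal.ofReal (Real.sqrt Real.pi * Real.sqrt (∫ p, v p ^ 2 ∂cylMeasure)) := by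
  refine (ENNReal.pow_right_strictMono two_ne_zero).injective ?_
  have hpos : 0 ≤ ∫ p, v p ^ 2 ∂cylMeasure := integral_nonneg fun _ => sq_nonneg _
  change _ ^ 2 = _ ^ 2
  rw [eLpNorm_two_sq, lintegral_cylinder (F := fun q => ‖v q‖ₑ ^ 2) (hv.enorm.pow_const 2),
    lintegral_enorm_sq_eq_ofReal hv2, ← ENNReal.ofReal_pow (by positivity), mul_pow,
    Real.sq_sqrt Real.pi_pos.le, Real.sq_sqrt hpos, ENNReal.ofReal_mul Real.pi_pos.le]

/-- On the rectangle the weight `2r` is at most `2`. -/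
theorem sqrt_integral_sq_cylMeasure_le {k : ℝ × ℝ → ℝ} (hk : Measurable k)
    (hk2 : Integrable (fun p => k p ^ 2) cylMeasure) (hkΩ : MemLp k 2 (volume.restrict Omega)) :
    Real.sqrt (∫ p, k p ^ 2 ∂cylMeasure) ≤
      Real.sqrt 2 * (eLpNorm k 2 (volume.restrict Omega)).toReal := by
  have hF : 0 ≤ (eLpNorm k 2 (volume.restrict Omega)).toReal := ENNReal.toReal_nonneg
  refine Real.sqrt_le_iff.2 ⟨by positivity, ?_⟩
  rw [mul_pow, Real.sq_sqrt zero_le_two, ← ENNReal.ofReal_le_ofReal_iff (by positivity),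
    ← lintegral_enorm_sq_eq_ofReal hk2, ENNReal.ofReal_mul zero_le_two, ENNReal.ofReal_pow hF,
    ENNReal.ofReal_toReal hkΩ.2.ne, eLpNorm_two_sq, cylMeasure_eq_withDensity,
    lintegral_withDensity_eq_lintegral_mul _ (by fun_prop) (hk.enorm.pow_const 2),
    ← lintegral_const_mul _ (hk.enorm.pow_const 2), ← restrict_interior_Omega]
  refine setLIntegral_mono (by fun_prop) fun p hp => ?_
  rw [interior_Omega] at hp
  rw [Pi.mul_apply]
  gcongr
  linarith [hp.1.2]

/-- Passage from a cubic bound in real numbers to the product of cube roots in `ℝ≥0∞`; the factor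
`4` is `c * 8 ^ (1 / 3)` for `c ≤ 2`. -/
theorem ofReal_mul_le_of_pow_three_le {c y : ℝ} {M V F : ℝ≥0∞} (hy : 0 ≤ y)
    (hc2 : c ≤ 2) (hM : M ≠ ∞) (hV : V ≠ ∞) (hF : F ≠ ∞)
    (h : y ^ 3 ≤ 8 * (M.toReal * V.toReal * F.toReal)) :
    ENNReal.ofReal (c * y) ≤
      4 * M ^ (1 / 3 : ℝ) * V ^ (1 / 3 : ℝ) * F ^ (1 / 3 : ℝ) := by
  have hM0 : 0 ≤ M.toReal := ENNReal.toReal_nonneg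
  have hV0 : 0 ≤ V.toReal := ENNReal.toReal_nonneg
  have hF0 : 0 ≤ F.toReal := ENNReal.toReal_nonneg
  have hroot : y ≤ 2 * (M.toReal ^ (1 / 3 : ℝ) * V.toReal ^ (1 / 3 : ℝ) *
      F.toReal ^ (1 / 3 : ℝ)) := by
    have hcube : ∀ x : ℝ, 0 ≤ x → (x ^ (1 / 3 : ℝ)) ^ 3 = x := fun x hx => by
      rw [← Real.rpow_natCast, ← Real.rpow_mul hx]; norm_num
    refine le_of_pow_le_pow_left₀ three_ne_zero (by positivity) (h.trans_eq ?_)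
    simp only [mul_pow, hcube _ hM0, hcube _ hV0, hcube _ hF0]
    norm_num
  have hreal : c * y ≤ 4 * M.toReal ^ (1 / 3 : ℝ) * V.toReal ^ (1 / 3 : ℝ) *
      F.toReal ^ (1 / 3 : ℝ) := by
    calc c * y ≤ 2 * (2 * (M.toReal ^ (1 / 3 : ℝ) * V.toReal ^ (1 / 3 : ℝ) *
          F.toReal ^ (1 / 3 : ℝ))) := mul_le_mul hc2 hroot hy zero_le_two
      _ = _ := by ring
  refine (ENNReal.ofReal_le_ofReal hreal).trans_eq ?_
  rw [ENNReal.ofReal_mul (by positivity), ENNReal.ofReal_mul (by positivity),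
    ENNReal.ofReal_mul (by positivity), ← ENNReal.ofReal_rpow_of_nonneg hM0 (by norm_num),
    ← ENNReal.ofReal_rpow_of_nonneg hV0 (by norm_num),
    ← ENNReal.ofReal_rpow_of_nonneg hF0 (by norm_num), ENNReal.ofReal_toReal hM,
    ENNReal.ofReal_toReal hV, ENNReal.ofReal_toReal hF]
  norm_num

end AbelStability

end

theorem mainTheorem2 :
    ∃ C : ℝ≥0, ∀ (u : (ℝ × ℝ) × ℝ → ℝ) (f : ℝ × ℝ → ℝ),
      AbelStability.IsAxisymmetricOn u AbelStability.cylinder →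
      AbelStability.IsBV (AbelStability.profile u) (interior AbelStability.Omega) →
      MemLp (AbelStability.profile u) ∞ (volume.restrict AbelStability.Omega) →
      AbelStability.essSupport (AbelStability.profile u) AbelStability.Omega
        ⊆ Ico 0 1 ×ˢ Icc (-1) 1 →
      (∀ᵐ p ∂(volume.restrict AbelStability.Omega),
        AbelStability.abelTransform (AbelStability.cylinder.indicator u) p = f p) →
      (∀ᵐ p ∂(volume.restrict AbelStability.Omega),
        IntegrableOn (AbelStability.abelIntegrand (AbelStability.cylinder.indicator u) p)
          (Ioi p.1)) ∧
      MemLp f 2 (volume.restrict AbelStability.Omega) ∧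
      MemLp u 2 (volume.restrict AbelStability.cylinder) ∧
      eLpNorm u 2 (volume.restrict AbelStability.cylinder) ≤
        C * eLpNorm (AbelStability.profile u) ∞ (volume.restrict AbelStability.Omega)
              ^ (1 / 3 : ℝ)
          * AbelStability.totalVariation (AbelStability.profile u)
              (interior AbelStability.Omega) ^ (1 / 3 : ℝ)
          * eLpNorm f 2 (volume.restrict AbelStability.Omega) ^ (1 / 3 : ℝ) := by
  open AbelStability in
  refine ⟨4, fun u f hu hBV hinf hsupp hf => ?_⟩
  obtain ⟨v, β, hvm, hβ, hvM, hvβ, hv0, huv⟩ := exists_bounded_representative hinf hsupp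
  set M := (eLpNorm (profile u) ∞ (volume.restrict Omega)).toReal with hM
  have hM0 : 0 ≤ M := ENNReal.toReal_nonneg
  have hTV : totalVariation v (interior Omega) = totalVariation (profile u) (interior Omega) :=
    totalVariation_congr_ae (by rw [restrict_interior_Omega]; exact huv.symm)
  have hmem : ∀ᵐ p ∂(volume.restrict Omega), p.1 ∈ Ioo (0 : ℝ) 1 := by
    rw [← restrict_interior_Omega]
    filter_upwards [ae_restrict_mem isOpen_interior.measurableSet] with p hp
    rw [interior_Omega] at hp
    exact hp.1
  have hintegrand := ae_abelIntegrand_eq hv0 huv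
  have hfk : f =ᵐ[volume.restrict Omega] kernelAbel v := by
    filter_upwards [hf, hintegrand, hmem] with p h1 h2 h3
    rw [← h1, abelTransform, integral_congr_ae h2]
    exact (integrableOn_abel_and_integral_eq hvm hvM hv0 h3).2
  have hkm := measurable_kernelAbel hvm
  have hkB : ∀ p : ℝ × ℝ, p.1 ∈ Ioo (0 : ℝ) 1 → |kernelAbel v p| ≤ 2 * M := fun p hp =>
    norm_kernelAbel_le hM0 (fun q _ => hvM q) hp
  have hfin : IsFiniteMeasure (volume.restrict Omega) :=
    isFiniteMeasure_restrict.2 (isCompact_Icc.prod isCompact_Icc).measure_lt_top.ne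
  have hkΩ : MemLp (kernelAbel v) 2 (volume.restrict Omega) :=
    MemLp.of_bound hkm.aestronglyMeasurable (2 * M) (hmem.mono fun p hp => hkB p hp)
  have hfΩ : MemLp f 2 (volume.restrict Omega) := (memLp_congr_ae hfk).2 hkΩ
  have hsq {F : ℝ × ℝ → ℝ} (hF : Measurable F) {B : ℝ}
      (hB : ∀ p : ℝ × ℝ, p.1 ∈ Ioo (0 : ℝ) 1 → |F p| ≤ B) :
      Integrable (fun p => F p ^ 2) cylMeasure :=
    (memLp_two_cylMeasure_of_bound hF hB).integrable_sq
  have hv2 := hsq hvm (fun p _ => hvM p)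
  have huv3 : u =ᵐ[volume.restrict cylinder] fun p => v (toCyl p) := by
    have hac : profile u =ᵐ[cylMeasure] v :=
      (restrict_interior_Omega ▸ cylMeasure_absolutelyContinuous).ae_le huv
    filter_upwards [quasiMeasurePreserving_toCyl.ae hac,
      ae_restrict_mem measurableSet_cylinder] with p hp hpc
    rw [hu.eq_profile hpc]
    exact hp
  have hnorm : eLpNorm u 2 (volume.restrict cylinder) =
      ENNReal.ofReal (Real.sqrt Real.pi * Real.sqrt (∫ p, v p ^ 2 ∂cylMeasure)) := by
    rw [eLpNorm_congr_ae huv3, eLpNorm_comp_toCyl hvm hv2]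
  refine ⟨?_, hfΩ, ⟨(hvm.comp measurable_toCyl).aestronglyMeasurable.congr huv3.symm, ?_⟩, ?_⟩
  · filter_upwards [hintegrand, hmem] with p h1 h2
    exact (integrable_congr h1).2 (integrableOn_abel_and_integral_eq hvm hvM hv0 h2).1
  · rw [hnorm]; exact ENNReal.ofReal_lt_top
  · rw [hnorm]
    refine ofReal_mul_le_of_pow_three_le (Real.sqrt_nonneg _) ?_
      hinf.2.ne hBV.2 hfΩ.2.ne ?_
    · rw [Real.sqrt_le_left zero_le_two]
      linarith [Real.pi_lt_four]
    -- `8` absorbs the constant `4 * (2 / π) * √2`, because `√2 ≤ π`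
    · have hcore := sqrt_integral_sq_pow_three_le hM0 hβ hvm hvM hvβ (hTV ▸ hBV.2)
      have hN := sqrt_integral_sq_cylMeasure_le hkm (hsq hkm hkB) hkΩ
      rw [← eLpNorm_congr_ae hfk] at hN
      rw [hTV] at hcore
      set V := (totalVariation (profile u) (interior Omega)).toReal
      set F := (eLpNorm f 2 (volume.restrict Omega)).toReal
      have hV0 : 0 ≤ V := ENNReal.toReal_nonneg
      have hF0 : 0 ≤ F := ENNReal.toReal_nonneg
      have hπ := Real.pi_pos
      have h2π : Real.sqrt 2 ≤ Real.pi := by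
        rw [Real.sqrt_le_left hπ.le]
        nlinarith [Real.pi_gt_three]
      calc _ ≤ _ := hcore
        _ ≤ 4 * (M * V) * (2 / Real.pi * (Real.pi * F)) := by
            have : Real.sqrt 2 * F ≤ Real.pi * F := by gcongr
            gcongr
            exact hN.trans this
        _ = 8 * (M * V * F) := by field_simp; ring
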